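/- **Definitions.** An operator-valued $C^*$-probability space $(\mathcal A,E,\mathcal B)$ consists of a unital $C^*$-algebra $\mathcal A$, a unital subalgebra $\mathcal B\subseteq\mathcal A$, and a completely positive linear map $E:\mathcal A\to\mathcal B$ with $E[b]=b$ for $b\in\mathcal B$ and $E[b_1ab_2+c]=b_1E[a]b_2+E[c]$ for $b_1,b_2\in\mathcal B$, $a,c\in\mathcal A$. For $x\in\mathcal A$, let $\mathcal A_x$ be the (possibly non-unital) $\mathcal B$-bimodule algebra generated by $x$, i.e. all finite sums of elements $b_1xb_2x\cdots xb_{n+1}$ with $n\ge 1$, $b_i\in\mathcal B$. We write $\mathcal A_{x_1}\prec\cdots\prec\mathcal A_{x_N}$ over $\mathcal B$ if the ordered family $(\mathcal A_{x_i})_{1\le i\le N}$ is monotone independent over $\mathcal B$: for all $n\ge1$, all $i_1,\dots,i_n\in\{1,\dots,N\}$ and $a_k\in\mathcal A_{x_{i_k}}$, $$E[a_1\cdots a_j\cdots a_n]=E[a_1\cdots a_{j-1}\,E[a_j]\,a_{j+1}\cdots a_n]\quad\text{whenever } i_{j-1}<i_j>i_{j+1},$$ where an inequality involving a non-existent index ($j=1$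 or $j=n$) is dropped. Let $\mathbb H^+(\mathcal B)$ be the set of $b\in\mathcal B$ such that $\operatorname{Im}(b)=\frac1{2i}(b-b^*)$ is positive and invertible, and let $G_a(b)=(b-a)^{-1}$. For a family $x=\{x_1,\dots,x_N\}$ put $$\alpha_2(x)=\max_i\|E[x_i^2]\|,\qquad \alpha_4(x)=\max_i\sup_{b\in\mathcal B,\ \|b\|=1}\|E[x_ib^*x_i^2bx_i]\|,\qquad \widetilde\alpha_4(x)=\max_i\|E[x_i^4]\|.$$ **Theorem 1.2 (Monotone Case).** Let $(\mathcal A,E,\mathcal B)$ be an operator-valued $C^*$-probability space, let $N\ge 1$, and let $x=\{x_1,\dots,x_N\}$ and $y=\{y_1,\dots,y_N\}$ be families of self-adjoint elements of $\mathcal A$ such that, for every $j$, $E[x_j]=E[y_j]=0$ and $E[x_jbx_j]=E[y_jby_j]$ for all $b\in\mathcal B$. Assume that $\mathcal A_{x_1}\prec\cdots\prec\mathcal A_{x_N}$ over $\mathcal B$ and $\mathcal A_{y_1}\prec\cdots\prec\mathcal A_{y_N}$ over $\mathcal B$. Put $\mathbf x_N=\sum_{i=1}^Nx_i$ and $\mathbf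 y_N=\sum_{i=1}^Ny_i$. Then for every $\mathfrak b\in\mathbb H^+(\mathcal B)$, $$\big\|E[G_{\mathbf x_N}(\mathfrak b)]-E[G_{\mathbf y_N}(\mathfrak b)]\big\|\le\|\operatorname{Im}(\mathfrak b)^{-1}\|^4\sqrt{\alpha_2(x)}\Big(\sqrt{\alpha_4(x)}+\sqrt{\alpha_4(y)}\Big)N.$$ If moreover $\mathcal B=\mathbb C 1$ and $E=\varphi(\cdot)1$ for a linear functional $\varphi$ on $\mathcal A$ (in particular if $(\mathcal A,\varphi)$ is a $W^*$-probability space and $E=\varphi$), then for every $\epsilon>0$ the difference $\operatorname{Im}\varphi[G_{\mathbf x_N}(t+i\epsilon)]-\operatorname{Im}\varphi[G_{\mathbf y_N}(t+i\epsilon)]$ is integrable in $t\in\mathbb R$ and $$\int_{\mathbb R}\big|\operatorname{Im}\varphi[G_{\mathbf x_N}(t+i\epsilon)]-\operatorname{Im}\varphi[G_{\mathbf y_N}(t+i\epsilon)]\big|\,dt\le\frac{\pi}{\epsilon^3}\sqrt{\alpha_2(x)}\Big(\sqrt{\widetilde\alpha_4(x)}+\sqrt{\widetilde\alpha_4(y)}\Big)N.$$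 -/

import Mathlib

open scoped CStarAlgebra ComplexStarModule

noncomputable section

namespace OVProb

variable {A : Type*} [CStarAlgebra A] [PartialOrder A] [StarOrderedRing A]

/-- `(A, E, B)` is an operator-valued C*-probability space: `A` is a unital C*-algebra, `B` a unital
subalgebra, and `E` is a completely positive map with values in `B` which is the identity on `B` and
is `B`-linear. The map `E` is regarded as a map `A → A` with range in `B`; positivity of a matrix
over `B` does not depend on whether it is tested in `M_n(B)` or in `M_n(A)`.
(That `B` is closed under the involution and norm closed is automatic: `B` is the fixed-point set of
the continuous map `E`, which commutes with the involution.) -/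
structure IsOVCStarProbabilitySpace (B : Subalgebra ℂ A) (E : A →CP A) : Prop where
  mem : ∀ a : A, E a ∈ B
  map_self : ∀ b ∈ B, E b = b
  map_bimodule : ∀ b₁ ∈ B, ∀ b₂ ∈ B, ∀ a c : A, E (b₁ * a * b₂ + c) = b₁ * E a * b₂ + E c

/-- The (possibly non-unital) `B`-bimodule algebra generated by `x`: all finite sums of elements
`b₁ x b₂ x ⋯ x bₙ₊₁` with `n ≥ 1` and `bᵢ ∈ B`. -/
def bimoduleAlgebra (B : Subalgebra ℂ A) (x : A) : NonUnitalSubalgebra ℂ A :=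
  NonUnitalAlgebra.adjoin ℂ {c | ∃ b₁ ∈ B, ∃ b₂ ∈ B, c = b₁ * x * b₂}

/-- Monotone independence with respect to `E` of a family of subalgebras indexed by a linearly
ordered set: in the expectation of a product `a₁ ⋯ aₙ` with `aₖ` in the algebra of index `iₖ`, a
letter `aⱼ` with `iⱼ₋₁ < iⱼ > iⱼ₊₁` may be replaced by `E[aⱼ]`; a neighbour that does not exist
imposes no condition. The word to the left (right) of `aⱼ` is the list `l` (`r`) of pairs
`(index, letter)`. -/
def MonotoneIndependent {Λ : Type*} [LinearOrder Λ] (E : A → A)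
    (S : Λ → NonUnitalSubalgebra ℂ A) : Prop :=
  ∀ (l r : List (Λ × A)) (i : Λ) (a : A),
    (∀ p ∈ l, p.2 ∈ S p.1) → (∀ p ∈ r, p.2 ∈ S p.1) → a ∈ S i →
    (∀ p ∈ l.getLast?, p.1 < i) → (∀ p ∈ r.head?, p.1 < i) →
    E ((l.map Prod.snd).prod * a * (r.map Prod.snd).prod) =
      E ((l.map Prod.snd).prod * E a * (r.map Prod.snd).prod)

/-- The operator-valued upper half-plane of `B`: the `b ∈ B` whose imaginary part `(b - b*) / (2i)`
is positive and invertible. -/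
def upperHalfPlane (B : Subalgebra ℂ A) : Set A :=
  {b | b ∈ B ∧ IsStrictlyPositive (ℑ b : A)}

/-- The resolvent `G_x(b) = (b - x)⁻¹`. -/
def G (x b : A) : A := Ring.inverse (b - x)

/-- `α₂(x) = max_i ‖E[x_i²]‖`. -/
def alpha₂ (E : A → A) {N : ℕ} (x : Fin N → A) : ℝ :=
  ⨆ i, ‖E (x i ^ 2)‖

/-- `α₄(x) = max_i sup ‖E[x_i b* x_i² b x_i]‖`, the supremum being over `b ∈ B` with `‖b‖ = 1`. -/
def alpha₄ (B : Subalgebra ℂ A) (E : A → A) {N : ℕ} (x : Fin N → A) : ℝ :=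
  ⨆ i, ⨆ b : {b : A // b ∈ B ∧ ‖b‖ = 1}, ‖E (x i * star b.1 * x i ^ 2 * b.1 * x i)‖

/-- `α̃₄(x) = max_i ‖E[x_i⁴]‖`. -/
def alphaTilde₄ (E : A → A) {N : ℕ} (x : Fin N → A) : ℝ :=
  ⨆ i, ‖E (x i ^ 4)‖

end OVProb

end

/-!
The theorem is proved by Lindeberg's exchange of one variable at a time, but no space carrying both
families is constructed: the two families are only compared through their reciprocal Cauchy
transforms `F_x(w) = E[G_x(w)]⁻¹`.

Monotone independence gives the subordination formula `E[G_{X+x}(w)] = E[G_X(F_x(w))]` when `X` is a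
sum of variables below `x` (`MonotoneIndependent.map_G_sum_insert`). Here no power series is needed:
the independence relation extends by continuity to the generated C*-algebras, which contain all the
resolvents, and the formula becomes a finite identity between resolvents. Hence replacing the
largest variable `x` by `y` amounts to comparing `G_X(F_x(w))` with `G_X(F_y(w))`, and then passing
from the point `w` to the point `F_y(w)`, whose imaginary part is no smaller.

For any self-adjoint `X` and any centred `y`, the element `G_X(F_y(w))` has the expansion
`G₀ + G₀ E[y w⁻¹ y] G₀ + G₀ M G₀` with `G₀ = G_X(w)` (`exists_G_reciprocalCauchy_eq`), so the first
two terms do not distinguish `x` from `y`. The remainder `M` is an inner product `⟨p, v⟩`, where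
`p = y (w⁻¹)* y` involves fourth moments of `y` and `v` is the image of `y` under the resolvent of
the monotone sum of `X` and `y`, acting on the tensor product which carries the form
`⟨a ⊗ c, a' ⊗ c'⟩ = c* E[a* a'] c'`. Complete positivity of `E` makes this form positive, so that
Cauchy–Schwarz (`norm_sq_inner_tensor_le`) and the dissipativity bound `‖v‖ ≤ β⁻¹ ‖E[y²]‖ ^ (1 / 2)`
for `β ≤ ℑ w` (`sq_mul_norm_tensorForm_le`) hold without any completion. This gives
`‖M‖ ≤ ‖E[p* p]‖ ^ (1 / 2) β⁻¹ ‖E[y²]‖ ^ (1 / 2)`, and the two outer factors `G₀` contribute `β⁻²`.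

In the scalar case the outer factors contribute `φ(G₀* G₀) ≤ -ε⁻¹ Im φ(G_X(w(t + iε)))` instead,
where `w` is a composition of reciprocal Cauchy transforms. As `w(z) - z` is bounded near infinity,
`φ(G_X(w(z)))` is `1 / z + O(|z|⁻²)`, and the Cauchy theorem on large rectangles shows that the
integral over `t` is at most `π / ε` (`integrable_and_integral_neg_im_apply_G_le`).
-/

/-! ### Imaginary parts, and Cauchy–Schwarz for completely positive maps -/

namespace OVProb

section Star

variable {A : Type*} [CStarAlgebra A]

lemma I_smul_sub_star (m : A) : Complex.I • (m - star m) = -((2 : ℝ) • (ℑ m : A)) := by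
  rw [imaginaryPart_apply_coe, smul_comm (2 : ℝ), smul_smul (2 : ℝ)]
  norm_num

lemma imaginaryPart_sub_isSelfAdjoint (w : A) {X : A} (hX : IsSelfAdjoint X) :
    (ℑ (w - X) : A) = ℑ w := by
  rw [map_sub, hX.imaginaryPart, sub_zero]

lemma star_mul_self_eq_of_imaginaryPart (m : A) (β : ℝ) :
    star m * m = star (m - (Complex.I * β) • (1 : A)) * (m - (Complex.I * β) • (1 : A)) +
      (2 * β) • ((ℑ m : A) - algebraMap ℝ A β) + algebraMap ℝ A (β ^ 2) := by
  have h := I_smul_sub_star m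
  have h2 : (2 * β) • (ℑ m : A) = -((Complex.I * β) • (m - star m)) := by
    rw [mul_comm Complex.I, mul_smul (β : ℂ), h, smul_neg, neg_neg, Complex.coe_smul, smul_smul,
      mul_comm]
  rw [smul_sub, h2]
  simp only [Algebra.algebraMap_eq_smul_one, star_sub, star_smul, star_one, sub_mul, mul_sub,
    smul_mul_assoc, mul_smul_comm, one_mul, mul_one, smul_sub, smul_smul, ← Complex.coe_smul]
  have e1 : star (Complex.I * (β:ℂ)) = -(Complex.I * β) := by
    simp
  rw [e1]
  have e2 : Complex.I * (β:ℂ) * -(Complex.I * β) = (β:ℂ)^2 := by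
    linear_combination (-(β:ℂ)^2) * Complex.I_mul_I
  rw [e2]
  push_cast
  module

end Star

variable {A : Type*} [CStarAlgebra A] [PartialOrder A] [StarOrderedRing A]

lemma le_star_mul_self_of_le_imaginaryPart {m : A} {β : ℝ} (hβ : 0 ≤ β)
    (h : algebraMap ℝ A β ≤ (ℑ m : A)) : algebraMap ℝ A (β ^ 2) ≤ star m * m := by
  rw [star_mul_self_eq_of_imaginaryPart m β]
  refine le_add_of_nonneg_left (add_nonneg (star_mul_self_nonneg _) ?_)
  exact smul_nonneg (by positivity) (sub_nonneg.2 h)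

lemma le_self_mul_star_of_le_imaginaryPart {m : A} {β : ℝ} (hβ : 0 ≤ β)
    (h : algebraMap ℝ A β ≤ (ℑ m : A)) : algebraMap ℝ A (β ^ 2) ≤ m * star m := by
  have h1 : algebraMap ℝ A β ≤ (ℑ (-star m) : A) := by
    rw [imaginaryPart_apply_coe] at h ⊢
    simpa [add_comm, sub_eq_add_neg] using h
  simpa using le_star_mul_self_of_le_imaginaryPart hβ h1

lemma isUnit_of_algebraMap_le {a : A} {c : ℝ} (hc : 0 < c) (h : algebraMap ℝ A c ≤ a) :
    IsUnit a :=
  CStarAlgebra.isUnit_of_le _ h (IsStrictlyPositive.iff_of_unital.2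
    ⟨algebraMap_nonneg A hc.le, (IsUnit.mk0 c hc.ne').map _⟩)

/-- An element whose imaginary part is bounded below by `β > 0` is invertible. -/
lemma isUnit_of_le_imaginaryPart {m : A} {β : ℝ} (hβ : 0 < β)
    (h : algebraMap ℝ A β ≤ (ℑ m : A)) : IsUnit m := by
  have h1 := isUnit_of_algebraMap_le (by positivity) (le_star_mul_self_of_le_imaginaryPart hβ.le h)
  have h2 := isUnit_of_algebraMap_le (by positivity) (le_self_mul_star_of_le_imaginaryPart hβ.le h)
  rw [isUnit_iff_exists_and_exists]
  refine ⟨⟨star m * Ring.inverse (m * star m), ?_⟩, ⟨Ring.inverse (star m * m) * star m, ?_⟩⟩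
  · rw [← mul_assoc, Ring.mul_inverse_cancel _ h2]
  · rw [mul_assoc, Ring.inverse_mul_cancel _ h1]

/-- The inverse of an element whose imaginary part is at least `β > 0` has norm at most `β⁻¹`. -/
lemma norm_inverse_le_of_le_imaginaryPart {m : A} {β : ℝ} (hβ : 0 < β)
    (h : algebraMap ℝ A β ≤ (ℑ m : A)) : ‖Ring.inverse m‖ ≤ β⁻¹ := by
  have hu := isUnit_of_le_imaginaryPart hβ h
  have h1 := star_left_conjugate_le_conjugate
    (le_star_mul_self_of_le_imaginaryPart hβ.le h) (Ring.inverse m)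
  have h2 : star (Ring.inverse m) * (star m * m) * Ring.inverse m = 1 := by
    rw [mul_assoc, mul_assoc, Ring.mul_inverse_cancel _ hu, mul_one, ← star_mul,
      Ring.mul_inverse_cancel _ hu, star_one]
  rw [h2, Algebra.algebraMap_eq_smul_one, mul_smul_comm, mul_one, smul_mul_assoc] at h1
  have h3 := CStarAlgebra.norm_le_norm_of_nonneg_of_le
    (smul_nonneg (by positivity) (star_mul_self_nonneg _)) h1
  rw [norm_smul, CStarRing.norm_star_mul_self, Real.norm_of_nonneg (by positivity)] at h3
  have h4 : (β * ‖Ring.inverse m‖) * (β * ‖Ring.inverse m‖) ≤ 1 := by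
    have : ‖(1 : A)‖ ≤ 1 := by
      rcases subsingleton_or_nontrivial A with hA | hA
      · rw [Subsingleton.elim (1 : A) 0, norm_zero]; exact zero_le_one
      · exact CStarRing.norm_one.le
    nlinarith
  rw [← one_div, le_div_iff₀ hβ, mul_comm]
  nlinarith [norm_nonneg (Ring.inverse m), mul_nonneg hβ.le (norm_nonneg (Ring.inverse m))]

lemma sum_conj_nonneg_of_nonneg {n : ℕ} {M : CStarMatrix (Fin n) (Fin n) A} (hM : 0 ≤ M)
    (c : Fin n → A) : 0 ≤ ∑ i, ∑ j, star (c i) * M i j * c j := by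
  rw [StarOrderedRing.nonneg_iff] at hM
  induction hM using AddSubmonoid.closure_induction with
  | mem M hM =>
    obtain ⟨K, rfl⟩ := hM
    have : ∑ i, ∑ j, star (c i) * (star K * K) i j * c j =
        ∑ k, star (∑ j, K k j * c j) * ∑ j, K k j * c j := by
      simp only [CStarMatrix.mul_apply, CStarMatrix.star_apply, star_sum, Finset.sum_mul,
        Finset.mul_sum, star_mul]
      rw [Finset.sum_congr rfl fun i _ => Finset.sum_comm, Finset.sum_comm]
      refine Finset.sum_congr rfl fun k _ => ?_
      rw [Finset.sum_comm]
      refine Finset.sum_congr rfl fun i _ => Finset.sum_congr rfl fun j _ => ?_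
      simp only [mul_assoc]
    simp only [this]
    exact Finset.sum_nonneg fun k _ => star_mul_self_nonneg _
  | zero => simp
  | add M N _ _ hM hN =>
    simpa only [CStarMatrix.add_apply, mul_add, add_mul, Finset.sum_add_distrib] using
      add_nonneg hM hN

/-- The sesquilinear form `⟨a ⊗ c, a' ⊗ c'⟩ = c* E[a* h a'] c'` is positive; this is what
complete positivity of `E` is used for. -/
lemma sum_conj_map_nonneg (E : A →CP A) {n : ℕ} (a c : Fin n → A) {h : A} (hh : 0 ≤ h) :
    0 ≤ ∑ i, ∑ j, star (c i) * E (star (a i) * h * a j) * c j := by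
  obtain ⟨s, rfl⟩ := CStarAlgebra.nonneg_iff_eq_star_mul_self.1 hh
  rcases Nat.eq_zero_or_pos n with rfl | hn
  · simp
  let i₀ : Fin n := ⟨0, hn⟩
  -- `star R * R` is the matrix `(aᵢ* h aⱼ)`
  let R : CStarMatrix (Fin n) (Fin n) A :=
    CStarMatrix.ofMatrix fun i j => if i = i₀ then s * a j else 0
  have hR : ∀ i j, (star R * R) i j = star (a i) * (star s * s) * a j := by
    intro i j
    have : ∀ i j, R i j = if i = i₀ then s * a j else 0 := fun _ _ => rfl
    rw [CStarMatrix.mul_apply]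
    simp [this, CStarMatrix.star_apply, mul_assoc]
  simpa only [CStarMatrix.map_apply, hR] using
    sum_conj_nonneg_of_nonneg (E.map_cstarMatrix_nonneg (star R * R) (star_mul_self_nonneg R)) c

/-- The abstract Cauchy–Schwarz inequality: `P`, `Q` and `M` play the roles of `⟨p, p⟩`, `⟨v, v⟩`
and `⟨p, v⟩`, and the hypothesis says that `⟨v - p l, v - p l⟩` is nonnegative. -/
lemma norm_sq_le_of_forall_nonneg {M P Q : A} (hP : 0 ≤ P)
    (h : ∀ l : A, 0 ≤ Q - star M * l - star l * M + star l * P * l) :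
    ‖M‖ ^ 2 ≤ ‖P‖ * ‖Q‖ := by
  -- `l = t M` turns the hypothesis into `(2t - t²‖P‖) M* M ≤ Q`; the best choice is `t = ‖P‖⁻¹`
  have key : ∀ t : ℝ, 0 < t → 0 ≤ 2 * t - t ^ 2 * ‖P‖ →
      (2 * t - t ^ 2 * ‖P‖) * ‖M‖ ^ 2 ≤ ‖Q‖ := by
    intro t ht ht2
    have h1 := h (t • M)
    have h2 : star M * P * M ≤ ‖P‖ • (star M * M) :=
      CStarAlgebra.star_left_conjugate_le_norm_smul (IsSelfAdjoint.of_nonneg hP)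
    have h3 : (2 * t - t ^ 2 * ‖P‖) • (star M * M) ≤ Q := by
      have h4 : t ^ 2 • (star M * P * M) ≤ t ^ 2 • (‖P‖ • (star M * M)) :=
        smul_le_smul_of_nonneg_left h2 (by positivity)
      have h5 : Q - star M * (t • M) - star (t • M) * M + star (t • M) * P * (t • M) =
          Q - (2 * t) • (star M * M) + t ^ 2 • (star M * P * M) := by
        simp only [star_smul, mul_smul_comm, smul_mul_assoc, star_trivial]
        module
      rw [h5] at h1
      have h6 := h1.trans (add_le_add_right h4 (Q - (2 * t) • (star M * M)))
      rw [← sub_nonneg]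
      convert h6 using 1
      module
    have h7 := CStarAlgebra.norm_le_norm_of_nonneg_of_le
      (smul_nonneg ht2 (star_mul_self_nonneg M)) h3
    rw [norm_smul, CStarRing.norm_star_mul_self, Real.norm_of_nonneg ht2] at h7
    nlinarith
  rcases (norm_nonneg P).eq_or_lt with h0 | h0
  · rw [← h0] at key ⊢
    rw [zero_mul]
    by_contra! hM
    have := key ((‖Q‖ + 1) / ‖M‖ ^ 2) (by positivity) (by simp; positivity)
    rw [mul_zero, sub_zero, mul_assoc, div_mul_cancel₀ _ hM.ne'] at this
    nlinarith [norm_nonneg Q]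
  · have := key ‖P‖⁻¹ (by positivity) (by field_simp; norm_num)
    field_simp at this
    nlinarith

/-- The square `⟨v, h v⟩` of the vector `v = a₁ ⊗ 1 + a₂ ⊗ k`, where simple tensors carry the
`A`-valued inner product `⟨a ⊗ c, a' ⊗ c'⟩ = c* E[a* a'] c'` and `h` acts on the first leg. -/
def tensorForm (E : A → A) (a₁ a₂ k h : A) : A :=
  E (star a₁ * h * a₁) + E (star a₁ * h * a₂) * k + star k * E (star a₂ * h * a₁) +
    star k * E (star a₂ * h * a₂) * k

lemma tensorForm_nonneg (E : A →CP A) (a₁ a₂ k : A) {h : A} (hh : 0 ≤ h) :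
    0 ≤ tensorForm E a₁ a₂ k h := by
  have := sum_conj_map_nonneg E ![a₁, a₂] ![1, k] hh
  simp only [Fin.sum_univ_two, Matrix.cons_val_zero, Matrix.cons_val_one, star_one,
    one_mul, mul_one] at this
  rw [tensorForm, add_assoc]
  exact this

lemma tensorForm_sub (E : A →CP A) (a₁ a₂ k h h' : A) :
    tensorForm E a₁ a₂ k (h - h') = tensorForm E a₁ a₂ k h - tensorForm E a₁ a₂ k h' := by
  simp only [tensorForm, mul_sub, sub_mul, map_sub]
  abel

lemma tensorForm_smul (E : A →CP A) (a₁ a₂ k h : A) (z : ℂ) :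
    tensorForm E a₁ a₂ k (z • h) = z • tensorForm E a₁ a₂ k h := by
  simp only [tensorForm, mul_smul_comm, smul_mul_assoc, map_smul, smul_add]

/-- Cauchy–Schwarz inequality between `p ⊗ 1` and `a₁ ⊗ 1 + a₂ ⊗ k`. -/
lemma norm_sq_inner_tensor_le (E : A →CP A) (p a₁ a₂ k : A) :
    ‖E (star p * a₁) + E (star p * a₂) * k‖ ^ 2 ≤
      ‖E (star p * p)‖ * ‖tensorForm E a₁ a₂ k 1‖ := by
  refine norm_sq_le_of_forall_nonneg (map_nonneg E (star_mul_self_nonneg p)) fun l => ?_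
  have := sum_conj_map_nonneg E ![a₁, a₂, p] ![1, k, -l] zero_le_one
  simp only [Fin.sum_univ_three, Matrix.cons_val_zero, Matrix.cons_val_one, star_one,
    one_mul, mul_one, Matrix.cons_val] at this
  convert this using 1
  have e1 : E (star a₁ * p) = star (E (star p * a₁)) := by
    rw [← map_star E]; simp
  have e2 : E (star a₂ * p) = star (E (star p * a₂)) := by
    rw [← map_star E]; simp
  rw [e1, e2, tensorForm]
  simp only [star_add, star_mul, star_neg, mul_one]
  noncomm_ring

/-- Cauchy–Schwarz inequality for a completely positive map. -/
lemma norm_sq_map_star_mul_le (E : A →CP A) (p a : A) :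
    ‖E (star p * a)‖ ^ 2 ≤ ‖E (star p * p)‖ * ‖E (star a * a)‖ := by
  simpa [tensorForm] using norm_sq_inner_tensor_le E p a 0 0

end OVProb

/-! ### The reciprocal Cauchy transform and the exchange of one variable -/

namespace OVProb

variable {A : Type*} [CStarAlgebra A] [PartialOrder A] [StarOrderedRing A]
  {B : Subalgebra ℂ A} {E : A →CP A}

namespace IsOVCStarProbabilitySpace

variable (hE : IsOVCStarProbabilitySpace B E)
include hE

lemma map_mul_left {b : A} (hb : b ∈ B) (a : A) : E (b * a) = b * E a := by
  simpa using hE.map_bimodule b hb 1 (one_mem B) a 0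

lemma map_mul_right {b : A} (hb : b ∈ B) (a : A) : E (a * b) = E a * b := by
  simpa using hE.map_bimodule 1 (one_mem B) b hb a 0

lemma star_mem {b : A} (hb : b ∈ B) : star b ∈ B := by
  rw [← hE.map_self b hb, ← map_star E b]
  exact hE.mem _

lemma inverse_mem {b : A} (hb : b ∈ B) : Ring.inverse b ∈ B := by
  by_cases h : IsUnit b
  · have h1 : b * E (Ring.inverse b) = 1 := by
      rw [← hE.map_mul_left hb, Ring.mul_inverse_cancel _ h, hE.map_self 1 (one_mem B)]
    have h2 : Ring.inverse b = E (Ring.inverse b) := by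
      calc Ring.inverse b = Ring.inverse b * (b * E (Ring.inverse b)) := by rw [h1, mul_one]
        _ = _ := Ring.inverse_mul_cancel_left _ _ h
    rw [h2]
    exact hE.mem _
  · rw [Ring.inverse_non_unit _ h]
    exact zero_mem B

/-- Kadison–Schwarz inequality. -/
lemma star_map_mul_map_le (a : A) : star (E a) * E a ≤ E (star a * a) := by
  have h := map_nonneg E (star_mul_self_nonneg (a - E a))
  have h1 : E (star (a - E a) * (a - E a)) = E (star a * a) - star (E a) * E a := by
    rw [star_sub, sub_mul, mul_sub, mul_sub, map_sub, map_sub, map_sub,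
      hE.map_mul_right (hE.mem a), hE.map_mul_left (hE.star_mem (hE.mem a)),
      hE.map_self _ (B.mul_mem (hE.star_mem (hE.mem a)) (hE.mem a)), map_star]
    abel
  rw [h1] at h
  exact sub_nonneg.1 h

end IsOVCStarProbabilitySpace

/-- The reciprocal Cauchy transform `F_x(b) = E[G_x(b)]⁻¹`. -/
noncomputable def reciprocalCauchy (E : A → A) (x b : A) : A := Ring.inverse (E (G x b))

omit [PartialOrder A] [StarOrderedRing A] in
lemma imaginaryPart_star_mul_mul (a m : A) :
    (ℑ (star a * m * a) : A) = star a * ℑ m * a := by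
  simp only [imaginaryPart_apply_coe, mul_smul_comm, smul_mul_assoc, mul_sub, sub_mul,
    star_mul, star_star, mul_assoc]

omit [PartialOrder A] [StarOrderedRing A] in
lemma star_mul_imaginaryPart_mul_eq {m g : A} (h : m * g = 1) :
    star g * ℑ m * g = (ℑ (star g) : A) := by
  rw [← imaginaryPart_star_mul_mul, mul_assoc, h, mul_one]

section Resolvent

variable {β : ℝ} (hβ : 0 < β) {w X : A} (hw : algebraMap ℝ A β ≤ (ℑ w : A))
  (hX : IsSelfAdjoint X)
include hβ hw hX

lemma isUnit_sub : IsUnit (w - X) :=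
  isUnit_of_le_imaginaryPart hβ (by rwa [imaginaryPart_sub_isSelfAdjoint _ hX])

lemma sub_mul_G : (w - X) * G X w = 1 := Ring.mul_inverse_cancel _ (isUnit_sub hβ hw hX)

lemma G_mul_sub : G X w * (w - X) = 1 := Ring.inverse_mul_cancel _ (isUnit_sub hβ hw hX)

lemma norm_G_le : ‖G X w‖ ≤ β⁻¹ :=
  norm_inverse_le_of_le_imaginaryPart hβ (by rwa [imaginaryPart_sub_isSelfAdjoint _ hX])

lemma smul_star_G_mul_G_le : β • (star (G X w) * G X w) ≤ (ℑ (star (G X w)) : A) := by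
  rw [← star_mul_imaginaryPart_mul_eq (sub_mul_G hβ hw hX), imaginaryPart_sub_isSelfAdjoint _ hX]
  have := star_left_conjugate_le_conjugate hw (G X w)
  rwa [Algebra.algebraMap_eq_smul_one, mul_smul_comm, mul_one, smul_mul_assoc] at this

/-- Since `-ℑ E[G] ≥ β E[G* G] ≥ β E[G]* E[G]`, the reciprocal of `E[G]` has imaginary part at
least `β`. -/
lemma isUnit_map_G_and_le_imaginaryPart_reciprocalCauchy
    (hE : IsOVCStarProbabilitySpace B E) :
    IsUnit (E (G X w)) ∧ algebraMap ℝ A β ≤ (ℑ (reciprocalCauchy E X w) : A) := by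
  have h1 : β • E (star (G X w) * G X w) ≤ (ℑ (star (E (G X w))) : A) := by
    have := OrderHomClass.mono E (smul_star_G_mul_G_le hβ hw hX)
    rw [map_imaginaryPart E, map_star E, ← Complex.coe_smul, map_smul, Complex.coe_smul] at this
    exact this
  have hu : IsUnit (E (G X w)) := by
    -- `1 = G* (w - X)* (w - X) G ≤ c G* G`
    set c : ℝ := ‖w - X‖ ^ 2 + 1 with hc
    have hc0 : 0 < c := by positivity
    have h2 : (1 : A) ≤ c • (star (G X w) * G X w) := by
      have h3 := star_left_conjugate_le_conjugate
        (CStarAlgebra.star_mul_le_algebraMap_norm_sq (a := w - X)) (G X w)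
      rw [Algebra.algebraMap_eq_smul_one, mul_smul_comm, mul_one, smul_mul_assoc,
        mul_assoc, mul_assoc, sub_mul_G hβ hw hX, mul_one, ← star_mul, sub_mul_G hβ hw hX,
        star_one] at h3
      refine h3.trans ?_
      rw [hc, add_smul]
      exact le_add_of_nonneg_right (smul_nonneg zero_le_one (star_mul_self_nonneg _))
    have h4 : (1 : A) ≤ c • E (star (G X w) * G X w) := by
      have := OrderHomClass.mono E h2
      rwa [hE.map_self 1 (one_mem B), ← Complex.coe_smul, map_smul, Complex.coe_smul] at this
    have h5 : algebraMap ℝ A (β * c⁻¹) ≤ (ℑ (star (E (G X w))) : A) := by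
      refine le_trans ?_ h1
      rw [Algebra.algebraMap_eq_smul_one, mul_smul]
      refine smul_le_smul_of_nonneg_left ?_ hβ.le
      calc c⁻¹ • (1 : A) ≤ c⁻¹ • (c • E (star (G X w) * G X w)) :=
            smul_le_smul_of_nonneg_left h4 (by positivity)
        _ = _ := by rw [smul_smul, inv_mul_cancel₀ hc0.ne', one_smul]
    exact isUnit_star.1 (isUnit_of_le_imaginaryPart (by positivity) h5)
  refine ⟨hu, ?_⟩
  set g := E (G X w)
  have h6 : β • (star g * g) ≤ (ℑ (star g) : A) :=
    (smul_le_smul_of_nonneg_left (hE.star_map_mul_map_le _) hβ.le).trans h1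
  have h7 : g * reciprocalCauchy E X w = 1 := Ring.mul_inverse_cancel _ hu
  have h8 := star_left_conjugate_le_conjugate h6 (reciprocalCauchy E X w)
  rw [← imaginaryPart_star_mul_mul, ← star_mul, h7, star_one, one_mul, mul_smul_comm,
    smul_mul_assoc, mul_assoc, mul_assoc, h7, mul_one, ← star_mul, h7, star_one] at h8
  rwa [Algebra.algebraMap_eq_smul_one]

end Resolvent

lemma reciprocalCauchy_mem (hE : IsOVCStarProbabilitySpace B E) (x w : A) :
    reciprocalCauchy E x w ∈ B := hE.inverse_mem (hE.mem _)

lemma star_tensorForm (E : A →CP A) (a₁ a₂ k h : A) :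
    star (tensorForm E a₁ a₂ k h) = tensorForm E a₁ a₂ k (star h) := by
  simp only [tensorForm, star_add, star_mul, ← map_star E, star_star, mul_assoc]
  abel

lemma imaginaryPart_tensorForm (E : A →CP A) (a₁ a₂ k h : A) :
    (ℑ (tensorForm E a₁ a₂ k h) : A) = tensorForm E a₁ a₂ k (ℑ h) := by
  simp only [imaginaryPart_apply_coe, ← Complex.coe_smul, tensorForm_smul, tensorForm_sub,
    star_tensorForm]

/-- The monotone sum of `X` and `y` is modelled by `y ⊗ 1 + (1 ⊗ X) P`, where
 `P (a ⊗ c) = 1 ⊗ E[a] c`. The resolvent of this operator at `w` maps `y ⊗ 1` to the vector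
`v = a₁ ⊗ 1 + a₂ ⊗ k` with `a₁ = G_y(w) y`, `a₂ = G_y(w)` and `k = X (E[a₁] + E[a₂] k)`. The usual
dissipativity argument bounds its norm by `β⁻¹ ‖E[y²]‖ ^ (1 / 2)`. -/
lemma sq_mul_norm_tensorForm_le {β : ℝ} (hβ : 0 < β) {w X y : A}
    (hw : algebraMap ℝ A β ≤ (ℑ w : A)) (hX : IsSelfAdjoint X) (hy : IsSelfAdjoint y) {k : A}
    (hk : k = X * (E (G y w * y) + E (G y w) * k)) :
    β ^ 2 * ‖tensorForm E (G y w * y) (G y w) k 1‖ ≤ ‖E (y ^ 2)‖ := by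
  set a₁ := G y w * y with ha₁
  set a₂ := G y w with ha₂
  set Q := tensorForm E a₁ a₂ k with hQ
  set r := E a₁ + E a₂ * k with hr
  set s := E (star a₁ * y) + star k * E (star a₂ * y) with hs
  have hm : (w - y) * a₂ = 1 := sub_mul_G hβ hw hy
  have hm1 : (w - y) * a₁ = y := by rw [ha₁, ← mul_assoc, hm, one_mul]
  -- `(w - y) v = y ⊗ 1 + 1 ⊗ k`, and the second term contributes a self-adjoint element
  have hQm : Q (w - y) = s + star r * X * r := by
    have h1 : star r = E (star a₁) + star k * E (star a₂) := by
      rw [hr, star_add, star_mul, map_star, map_star]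
    rw [mul_assoc (star r), ← hk, h1, hQ, tensorForm, mul_assoc (star a₁), hm1,
      mul_assoc (star a₁), hm, mul_assoc (star a₂), hm1, mul_assoc (star a₂), hm, hs]
    simp only [mul_one]
    noncomm_ring
  have hQim : Q (ℑ w : A) = (ℑ s : A) := by
    rw [← imaginaryPart_sub_isSelfAdjoint w hy, hQ, ← imaginaryPart_tensorForm, ← hQ, hQm,
      map_add, AddSubgroup.coe_add, (hX.conjugate' r).imaginaryPart, ZeroMemClass.coe_zero,
      add_zero]
  have h1 : β • Q 1 ≤ (ℑ s : A) := by
    have h2 := tensorForm_nonneg E a₁ a₂ k (sub_nonneg.2 hw)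
    rw [tensorForm_sub, ← hQ, hQim, Algebra.algebraMap_eq_smul_one, ← Complex.coe_smul, hQ,
      tensorForm_smul, Complex.coe_smul] at h2
    exact sub_nonneg.1 h2
  have hQ0 : 0 ≤ Q 1 := tensorForm_nonneg E a₁ a₂ k zero_le_one
  have h2 : β * ‖Q 1‖ ≤ ‖s‖ := by
    have h3 := CStarAlgebra.norm_le_norm_of_nonneg_of_le (smul_nonneg hβ.le hQ0) h1
    rw [norm_smul, Real.norm_of_nonneg hβ.le] at h3
    exact h3.trans (imaginaryPart.norm_le s)
  have h3 : ‖s‖ ^ 2 ≤ ‖E (y ^ 2)‖ * ‖Q 1‖ := by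
    have h4 := norm_sq_inner_tensor_le E y a₁ a₂ k
    have h5 : E (star y * a₁) + E (star y * a₂) * k = star s := by
      simp only [hs, star_add, star_mul (star k), ← map_star E, star_mul _ y, star_star]
    rw [h5, norm_star, hy.star_eq, ← sq] at h4
    exact h4
  rcases (norm_nonneg (Q 1)).eq_or_lt with h0 | h0
  · rw [← h0]; simp
  · have h6 : (β * ‖Q 1‖) ^ 2 ≤ ‖s‖ ^ 2 := by gcongr
    refine le_of_mul_le_mul_right ?_ h0
    nlinarith

/-- Third-order expansion of `G_X(F_y(w))`, which for `y` monotone independent of `X` is the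
conditional expectation of `G_{X+y}(w)`: the remainder is bounded in terms of the second and fourth
moments of `y`, uniformly in `X`. -/
lemma exists_G_reciprocalCauchy_eq (hE : IsOVCStarProbabilitySpace B E) {β : ℝ} (hβ : 0 < β)
    {w X y : A} (hwB : w ∈ B) (hw : algebraMap ℝ A β ≤ (ℑ w : A)) (hX : IsSelfAdjoint X)
    (hy : IsSelfAdjoint y) (hEy : E y = 0) :
    ∃ M : A, G X (reciprocalCauchy E y w) =
        G X w + G X w * E (y * Ring.inverse w * y) * G X w + G X w * M * G X w ∧
      ‖M‖ ≤ √‖E (y * Ring.inverse w * y ^ 2 * star (Ring.inverse w) * y)‖ *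
        (β⁻¹ * √‖E (y ^ 2)‖) := by
  set u := Ring.inverse w with hu
  have huB : u ∈ B := hE.inverse_mem hwB
  have hwu : IsUnit w := isUnit_of_le_imaginaryPart hβ hw
  have huw : u * w = 1 := Ring.inverse_mul_cancel _ hwu
  have hwu' : w * u = 1 := Ring.mul_inverse_cancel _ hwu
  set R := G y w with hR
  have hR1 : R * (w - y) = 1 := G_mul_sub hβ hw hy
  have hR2 : (w - y) * R = 1 := sub_mul_G hβ hw hy
  have hRl : R = u + u * y * R := by
    calc R = u * ((w - y) * R) + u * y * R := by rw [← mul_assoc, mul_sub, huw]; noncomm_ring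
      _ = _ := by rw [hR2, mul_one]
  have hRr : R = u + R * y * u := by
    calc R = (R * (w - y)) * u + R * y * u := by rw [mul_assoc, sub_mul, hwu']; noncomm_ring
      _ = _ := by rw [hR1, one_mul]
  set T := E (y * R * y) with hT
  have hRy : E (R * y) = u * T := by
    conv_lhs => rw [hRl]
    rw [add_mul, map_add, hE.map_mul_left huB, hEy, mul_zero, zero_add,
      show u * y * R * y = u * (y * R * y) by noncomm_ring, hE.map_mul_left huB]
  have hyR : E (y * R) = T * u := by
    conv_lhs => rw [hRr]
    rw [mul_add, map_add, hE.map_mul_right huB, hEy, zero_mul, zero_add,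
      show y * (R * y * u) = (y * R * y) * u by noncomm_ring, hE.map_mul_right huB]
  have hyuyR : E (y * u * y * R) = T * u := by
    rw [show y * u * y * R = y * R - y * u by
      conv_rhs => rw [hRl]
      noncomm_ring, map_sub, hyR, hE.map_mul_right huB, hEy, zero_mul, sub_zero]
  have hyuyRy : E (y * u * y * (R * y)) = T - E (y * u * y) := by
    rw [show y * u * y * (R * y) = y * R * y - y * u * y by
      conv_rhs => rw [hRl]
      noncomm_ring, map_sub]
  obtain ⟨hgu, hF⟩ := isUnit_map_G_and_le_imaginaryPart_reciprocalCauchy hβ hw hy hE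
  set F := reciprocalCauchy E y w with hFdef
  set g := E R with hg
  have hgF : F * g = 1 := Ring.inverse_mul_cancel _ hgu
  have hgexp : g = u + u * T * u := by
    rw [hg]
    conv_lhs => rw [hRl]
    rw [map_add, hE.map_self _ huB, mul_assoc, hE.map_mul_left huB, hyR, mul_assoc]
  have hLu : IsUnit (1 - X * g) := by
    rw [show 1 - X * g = (F - X) * g by rw [sub_mul, hgF]]
    exact (isUnit_sub hβ hF hX).mul hgu
  set L := Ring.inverse (1 - X * g) with hL
  have hL1 : (1 - X * g) * L = 1 := Ring.mul_inverse_cancel _ hLu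
  have hL2 : L * (1 - X * g) = 1 := Ring.inverse_mul_cancel _ hLu
  have hGF : G X F = g * L := by
    rw [← mul_one (G X F), ← hL1, show 1 - X * g = (F - X) * g by rw [sub_mul, hgF],
      mul_assoc, ← mul_assoc, G_mul_sub hβ hF hX, one_mul]
  set k := L * X * (u * T) with hk
  have hkX : k = X * (E (R * y) + E R * k) := by
    have : L = 1 + X * g * L := by
      rw [sub_mul, one_mul] at hL1
      rw [← hL1]; abel
    rw [hRy, ← hg, hk]
    conv_lhs => rw [this]
    noncomm_ring
  refine ⟨E (y * u * y * (R * y)) + E (y * u * y * R) * k, ?_, ?_⟩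
  · -- multiplied by `w - X` on both sides, the identity is an expansion of `(w - X) g L (w - X)`
    have hwg : w * g = 1 + T * u := by
      rw [hgexp, mul_add, mul_assoc u, ← mul_assoc w, hwu', one_mul]
    have hgw : g * w = 1 + u * T := by
      rw [hgexp, add_mul, mul_assoc, huw, mul_one]
    have e1 : (w - X) * (g * L) = T * u * L + 1 := by
      calc (w - X) * (g * L) = w * g * L - X * g * L := by noncomm_ring
        _ = T * u * L + (1 - X * g) * L := by rw [hwg]; noncomm_ring
        _ = _ := by rw [hL1]
    have e2 : L * (w - X) = w + L * X * (u * T) := by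
      have h3 : w = L * w - L * X * (g * w) := by
        calc w = L * (1 - X * g) * w := by rw [hL2, one_mul]
          _ = _ := by noncomm_ring
      rw [hgw] at h3
      calc L * (w - X) = L * w - L * X * (1 + u * T) + L * X * (u * T) := by noncomm_ring
        _ = _ := by rw [← h3]
    have e3 : (w - X) * (g * L) * (w - X) =
        (w - X) + E (y * u * y) + (E (y * u * y * (R * y)) + E (y * u * y * R) * k) := by
      rw [e1, add_mul, mul_assoc (T * u), e2, hyuyRy, hyuyR, hk, mul_add, mul_assoc T, huw]
      noncomm_ring
    have h1 : G X w * (w - X) = 1 := G_mul_sub hβ hw hX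
    have h2 : (w - X) * G X w = 1 := sub_mul_G hβ hw hX
    calc G X F = G X w * (w - X) * (g * L) * ((w - X) * G X w) := by
          rw [h1, h2, one_mul, mul_one, hGF]
      _ = G X w * ((w - X) * (g * L) * (w - X)) * G X w := by noncomm_ring
      _ = G X w * (w - X) * G X w + G X w * E (y * u * y) * G X w +
          G X w * (E (y * u * y * (R * y)) + E (y * u * y * R) * k) * G X w := by
        rw [e3]; noncomm_ring
      _ = _ := by rw [h1, one_mul]
  · have h1 := norm_sq_inner_tensor_le E (y * star u * y) (R * y) R k
    have h2 := sq_mul_norm_tensorForm_le (E := E) hβ hw hX hy hkX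
    rw [show star (y * star u * y) = y * u * y by simp [hy.star_eq, mul_assoc],
      show y * u * y * (y * star u * y) = y * u * y ^ 2 * star u * y by noncomm_ring] at h1
    refine abs_le_of_sq_le_sq' ?_ (by positivity) |>.2
    rw [mul_pow, mul_pow, Real.sq_sqrt (norm_nonneg _), Real.sq_sqrt (norm_nonneg _)]
    refine h1.trans (mul_le_mul_of_nonneg_left ?_ (norm_nonneg _))
    rw [inv_pow, ← div_eq_inv_mul, le_div_iff₀ (by positivity), mul_comm]
    exact h2

/-- One replacement in the Lindeberg exchange: if `x` and `y` have the same first two moments, then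
`G_X(F_x(w))` and `G_X(F_y(w))` agree to second order. -/
lemma norm_map_G_reciprocalCauchy_sub_le (hE : IsOVCStarProbabilitySpace B E) {β : ℝ}
    (hβ : 0 < β) {w X x y : A} (hwB : w ∈ B) (hw : algebraMap ℝ A β ≤ (ℑ w : A))
    (hX : IsSelfAdjoint X) (hx : IsSelfAdjoint x) (hy : IsSelfAdjoint y) (hEx : E x = 0)
    (hEy : E y = 0) (hvar : ∀ b ∈ B, E (x * b * x) = E (y * b * y)) :
    ‖E (G X (reciprocalCauchy E x w)) - E (G X (reciprocalCauchy E y w))‖ ≤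
      β⁻¹ * √‖E (x ^ 2)‖ * (√‖E (x * Ring.inverse w * x ^ 2 * star (Ring.inverse w) * x)‖ +
        √‖E (y * Ring.inverse w * y ^ 2 * star (Ring.inverse w) * y)‖) *
        √(‖E (G X w * star (G X w))‖ * ‖E (star (G X w) * G X w)‖) := by
  obtain ⟨M, hM, hMn⟩ := exists_G_reciprocalCauchy_eq hE hβ hwB hw hX hx hEx
  obtain ⟨M', hM', hMn'⟩ := exists_G_reciprocalCauchy_eq hE hβ hwB hw hX hy hEy
  have h2 : E (y ^ 2) = E (x ^ 2) := by
    simpa [sq] using (hvar 1 (one_mem B)).symm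
  rw [h2] at hMn'
  have h0 := hvar _ (hE.inverse_mem hwB)
  set D := M - M'
  have hD : G X (reciprocalCauchy E x w) - G X (reciprocalCauchy E y w) =
      star (star (G X w)) * (D * G X w) := by
    rw [hM, hM', h0, star_star, show D = M - M' from rfl]; noncomm_ring
  have hDn : ‖D‖ ≤ β⁻¹ * √‖E (x ^ 2)‖ *
      (√‖E (x * Ring.inverse w * x ^ 2 * star (Ring.inverse w) * x)‖ +
        √‖E (y * Ring.inverse w * y ^ 2 * star (Ring.inverse w) * y)‖) := by
    refine (norm_sub_le _ _).trans ?_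
    linarith
  rw [← map_sub, hD]
  have h3 := norm_sq_map_star_mul_le E (star (G X w)) (D * G X w)
  have h4 : ‖E (star (D * G X w) * (D * G X w))‖ ≤ ‖D‖ ^ 2 * ‖E (star (G X w) * G X w)‖ := by
    have h5 : star (D * G X w) * (D * G X w) ≤ (‖D‖ ^ 2) • (star (G X w) * G X w) := by
      have := star_left_conjugate_le_conjugate
        (CStarAlgebra.star_mul_le_algebraMap_norm_sq (a := D)) (G X w)
      rw [Algebra.algebraMap_eq_smul_one, mul_smul_comm, mul_one, smul_mul_assoc] at this
      rwa [star_mul, mul_assoc, ← mul_assoc (star D), ← mul_assoc]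
    have h6 := OrderHomClass.mono E h5
    rw [← Complex.coe_smul, map_smul, Complex.coe_smul] at h6
    have h7 := CStarAlgebra.norm_le_norm_of_nonneg_of_le
      (map_nonneg E (star_mul_self_nonneg (D * G X w))) h6
    rwa [norm_smul, Real.norm_of_nonneg (by positivity)] at h7
  rw [star_star] at h3 ⊢
  refine le_trans ?_ (mul_le_mul_of_nonneg_right hDn (Real.sqrt_nonneg _))
  refine abs_le_of_sq_le_sq' ?_ (by positivity) |>.2
  rw [mul_pow, Real.sq_sqrt (by positivity)]
  calc _ ≤ _ := h3
    _ ≤ ‖E (G X w * star (G X w))‖ * (‖D‖ ^ 2 * ‖E (star (G X w) * G X w)‖) := by gcongr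
    _ = _ := by ring

end OVProb

/-! ### Subordination for monotone independence -/

namespace OVProb

section BimoduleAlgebra

variable {A : Type*} [CStarAlgebra A] {B : Subalgebra ℂ A}

lemma mul_mem_bimoduleAlgebra_of_left {x b s : A} (hb : b ∈ B) (hs : s ∈ bimoduleAlgebra B x) :
    b * s ∈ bimoduleAlgebra B x := by
  induction hs using NonUnitalAlgebra.adjoin_induction with
  | mem s hs =>
    obtain ⟨b₁, hb₁, b₂, hb₂, rfl⟩ := hs
    exact NonUnitalAlgebra.subset_adjoin ℂ
      ⟨b * b₁, B.mul_mem hb hb₁, b₂, hb₂, by simp only [mul_assoc]⟩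
  | add s t _ _ hs ht => rw [mul_add]; exact add_mem hs ht
  | zero => rw [mul_zero]; exact zero_mem _
  | mul s t _ ht hs _ => rw [← mul_assoc]; exact mul_mem hs ht
  | smul r s _ hs => rw [mul_smul_comm]; exact SMulMemClass.smul_mem r hs

lemma mul_mem_bimoduleAlgebra_self {x b : A} (hb : b ∈ B) : x * b ∈ bimoduleAlgebra B x :=
  NonUnitalAlgebra.subset_adjoin ℂ ⟨1, one_mem B, b, hb, by rw [one_mul]⟩

lemma self_mem_bimoduleAlgebra (x : A) : x ∈ bimoduleAlgebra B x := by
  simpa using mul_mem_bimoduleAlgebra_self (B := B) (x := x) (one_mem B)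

/-- A product of elements of `B` and of letters `x i`, `i ∈ I`, is an element of `B` or a nonempty
word in the algebras generated by the letters. -/
lemma mem_or_exists_word_of_mem_closure {Λ : Type*} {x : Λ → A} {I : Set Λ} {m : A}
    (hm : m ∈ Submonoid.closure ((B : Set A) ∪ x '' I)) :
    m ∈ B ∨ ∃ l : List (Λ × A), l ≠ [] ∧ (∀ p ∈ l, p.1 ∈ I) ∧
      (∀ p ∈ l, p.2 ∈ bimoduleAlgebra B (x p.1)) ∧ m = (l.map Prod.snd).prod := by
  induction hm using Submonoid.closure_induction_left with
  | one => exact .inl (one_mem B)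
  | mul_left a ha m _ hm =>
    rcases ha with ha | ⟨i, hi, rfl⟩
    · rcases hm with hm | ⟨l, hl0, hlI, hl, rfl⟩
      · exact .inl (B.mul_mem ha hm)
      · right
        obtain ⟨p, l, rfl⟩ := List.exists_cons_of_ne_nil hl0
        simp only [List.forall_mem_cons] at hlI hl
        refine ⟨(p.1, a * p.2) :: l, by simp, ?_, ?_, by simp [mul_assoc]⟩
        · simpa only [List.forall_mem_cons] using hlI
        · simpa only [List.forall_mem_cons] using
            ⟨mul_mem_bimoduleAlgebra_of_left ha hl.1, hl.2⟩
    · right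
      rcases hm with hm | ⟨l, -, hlI, hl, rfl⟩
      · exact ⟨[(i, x i * m)], by simp, by simpa using hi,
          by simpa using mul_mem_bimoduleAlgebra_self hm, by simp⟩
      · refine ⟨(i, x i) :: l, by simp, ?_, ?_, by simp⟩
        · simpa only [List.forall_mem_cons] using ⟨hi, hlI⟩
        · simpa only [List.forall_mem_cons] using ⟨self_mem_bimoduleAlgebra _, hl⟩

lemma list_prod_mem_bimoduleAlgebra {Λ : Type*} {x : Λ → A} {i : Λ} {l : List (Λ × A)}
    (hl0 : l ≠ []) (hli : ∀ p ∈ l, p.1 ∈ ({i} : Set Λ))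
    (hl : ∀ p ∈ l, p.2 ∈ bimoduleAlgebra B (x p.1)) :
    (l.map Prod.snd).prod ∈ bimoduleAlgebra B (x i) := by
  induction l with
  | nil => exact absurd rfl hl0
  | cons p l ih =>
    simp only [List.forall_mem_cons] at hli hl
    have hp : p.2 ∈ bimoduleAlgebra B (x i) := by
      rw [← Set.mem_singleton_iff.1 hli.1]; exact hl.1
    rcases eq_or_ne l [] with rfl | h
    · simpa using hp
    · rw [List.map_cons, List.prod_cons]
      exact mul_mem hp (ih h hli.2 hl.2)

/-- The C*-algebra generated by `B` and the `x i`, `i ∈ I`. -/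
noncomputable def generatedAlgebra {Λ : Type*} (B : Subalgebra ℂ A) (x : Λ → A) (I : Set Λ) :
    StarSubalgebra ℂ A :=
  (StarAlgebra.adjoin ℂ ((B : Set A) ∪ x '' I)).topologicalClosure

variable {Λ : Type*} {x : Λ → A} {I : Set Λ}

lemma mem_generatedAlgebra_of_mem {b : A} (hb : b ∈ B) : b ∈ generatedAlgebra B x I :=
  StarSubalgebra.le_topologicalClosure _ (StarAlgebra.subset_adjoin ℂ _ (.inl hb))

lemma apply_mem_generatedAlgebra {i : Λ} (hi : i ∈ I) : x i ∈ generatedAlgebra B x I :=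
  StarSubalgebra.le_topologicalClosure _ (StarAlgebra.subset_adjoin ℂ _ (.inr ⟨i, hi, rfl⟩))

lemma inverse_mem_generatedAlgebra {a : A} (ha : a ∈ generatedAlgebra B x I) :
    Ring.inverse a ∈ generatedAlgebra B x I := by
  by_cases h : IsUnit a
  · have : IsClosed (generatedAlgebra B x I : Set A) :=
      StarSubalgebra.isClosed_topologicalClosure _
    obtain ⟨u, hu⟩ := (StarSubalgebra.coe_isUnit (a := ⟨a, ha⟩)).1 h
    have h1 : a * ((↑u⁻¹ : generatedAlgebra B x I) : A) = 1 := by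
      have := congrArg Subtype.val u.mul_inv
      rw [hu] at this
      exact this
    rw [← mul_one (Ring.inverse a), ← h1, Ring.inverse_mul_cancel_left _ _ h]
    exact SetLike.coe_mem _
  · rw [Ring.inverse_non_unit _ h]
    exact zero_mem _

lemma generatedAlgebra_induction (hB : ∀ b ∈ B, star b ∈ B) (hx : ∀ i, IsSelfAdjoint (x i))
    {P : A → Prop} (mem : ∀ m ∈ Submonoid.closure ((B : Set A) ∪ x '' I), P m)
    (zero : P 0) (add : ∀ a b, P a → P b → P (a + b)) (smul : ∀ (z : ℂ) a, P a → P (z • a))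
    (closed : IsClosed {a | P a}) {a : A} (ha : a ∈ generatedAlgebra B x I) : P a := by
  have hstar : ((B : Set A) ∪ x '' I) ∪ star ((B : Set A) ∪ x '' I) = (B : Set A) ∪ x '' I := by
    refine Set.union_eq_left.2 fun a ha => ?_
    rcases ha with ha | ⟨i, hi, ha⟩
    · exact .inl (by simpa using hB _ ha)
    · refine .inr ⟨i, hi, ?_⟩
      rw [← star_star a, ← ha, (hx i).star_eq]
  have h1 : ((StarAlgebra.adjoin ℂ ((B : Set A) ∪ x '' I) : StarSubalgebra ℂ A) : Set A) ⊆
      {a | P a} := by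
    intro a ha
    have h2 : a ∈ Algebra.adjoin ℂ ((B : Set A) ∪ x '' I) := by
      rw [← hstar]; exact ha
    rw [← Subalgebra.mem_toSubmodule, Algebra.adjoin_eq_span] at h2
    exact Submodule.span_induction (p := fun a _ => P a) mem zero
      (fun a b _ _ => add a b) (fun z a _ => smul z a) h2
  exact closure_minimal h1 closed ha

end BimoduleAlgebra

variable {A : Type*} [CStarAlgebra A] [PartialOrder A] [StarOrderedRing A]
  {B : Subalgebra ℂ A} {E : A →CP A} {Λ : Type*} [LinearOrder Λ] {x : Λ → A}

lemma MonotoneIndependent.map_mul_mul_of_mem_closure (hE : IsOVCStarProbabilitySpace B E)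
    (hm : MonotoneIndependent E fun j => bimoduleAlgebra B (x j)) {i : Λ} {I : Set Λ}
    (hI : ∀ j ∈ I, j < i) {a c t : A} (ha : a ∈ Submonoid.closure ((B : Set A) ∪ x '' I))
    (hc : c ∈ Submonoid.closure ((B : Set A) ∪ x '' {i}))
    (ht : t = 1 ∨ ∃ j < i, ∃ d ∈ Submonoid.closure ((B : Set A) ∪ x '' Set.univ), t = x j * d) :
    E (a * c * t) = E (a * E c * t) := by
  rcases mem_or_exists_word_of_mem_closure hc with hc | ⟨l', h0', hl'I, hl', rfl⟩
  · rw [hE.map_self c hc]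
  have hc' := list_prod_mem_bimoduleAlgebra h0' hl'I hl'
  set c := (l'.map Prod.snd).prod
  obtain ⟨r, hr, hri, rfl⟩ : ∃ r : List (Λ × A), (∀ p ∈ r, p.2 ∈ bimoduleAlgebra B (x p.1)) ∧
      (∀ p ∈ r.head?, p.1 < i) ∧ t = (r.map Prod.snd).prod := by
    rcases ht with rfl | ⟨j, hj, d, hd, rfl⟩
    · exact ⟨[], by simp, by simp, by simp⟩
    · rcases mem_or_exists_word_of_mem_closure hd with hd | ⟨r, -, -, hr, rfl⟩
      · exact ⟨[(j, x j * d)], by simpa using mul_mem_bimoduleAlgebra_self hd,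
          by simpa using hj, by simp⟩
      · refine ⟨(j, x j) :: r, ?_, by simpa using hj, by simp⟩
        simpa only [List.forall_mem_cons] using ⟨self_mem_bimoduleAlgebra _, hr⟩
  rcases mem_or_exists_word_of_mem_closure ha with ha | ⟨l, -, hlI, hl, rfl⟩
  · have := hm [] r i c (by simp) hr hc' (by simp) hri
    simp only [List.map_nil, List.prod_nil, one_mul] at this
    rw [mul_assoc, hE.map_mul_left ha, this, mul_assoc, hE.map_mul_left ha]
  · exact hm l r i c hl hr hc' (fun p hp => hI _ (hlI p (List.mem_of_getLast? hp))) hri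

/-- Monotone independence passes to the generated C*-algebras. -/
lemma MonotoneIndependent.map_mul_mul (hE : IsOVCStarProbabilitySpace B E)
    (hx : ∀ j, IsSelfAdjoint (x j))
    (hm : MonotoneIndependent E fun j => bimoduleAlgebra B (x j)) {i : Λ} {I : Set Λ}
    (hI : ∀ j ∈ I, j < i) {a c t : A} (ha : a ∈ generatedAlgebra B x I)
    (hc : c ∈ generatedAlgebra B x {i})
    (ht : t = 1 ∨ ∃ j < i, ∃ d ∈ generatedAlgebra B x Set.univ, t = x j * d) :
    E (a * c * t) = E (a * E c * t) := by
  have hEc : Continuous E := map_continuous E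
  have hB : ∀ b ∈ B, star b ∈ B := fun b hb => hE.star_mem hb
  revert t
  refine generatedAlgebra_induction hB hx (P := fun a => ∀ {t : A}, (t = 1 ∨ ∃ j < i,
    ∃ d ∈ generatedAlgebra B x Set.univ, t = x j * d) → E (a * c * t) = E (a * E c * t))
    ?_ ?_ ?_ ?_ ?_ ha
  · intro a ha
    refine generatedAlgebra_induction hB hx (P := fun c => ∀ {t : A}, (t = 1 ∨ ∃ j < i,
      ∃ d ∈ generatedAlgebra B x Set.univ, t = x j * d) → E (a * c * t) = E (a * E c * t))
      ?_ ?_ ?_ ?_ ?_ hc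
    · rintro c hc t (rfl | ⟨j, hj, d, hd, rfl⟩)
      · exact hm.map_mul_mul_of_mem_closure hE hI ha hc (.inl rfl)
      · refine generatedAlgebra_induction hB hx
          (P := fun d => E (a * c * (x j * d)) = E (a * E c * (x j * d))) ?_ ?_ ?_ ?_ ?_ hd
        · exact fun d hd => hm.map_mul_mul_of_mem_closure hE hI ha hc (.inr ⟨j, hj, d, hd, rfl⟩)
        · simp
        · intro d d' h h'
          simp only [mul_add, map_add, h, h']
        · intro z d h
          simp only [mul_smul_comm, map_smul, h]
        · exact isClosed_eq (hEc.comp (by fun_prop)) (hEc.comp (by fun_prop))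
    · simp
    · intro c c' h h' t ht
      simp only [mul_add, add_mul, map_add, h ht, h' ht]
    · intro z c h t ht
      simp only [mul_smul_comm, smul_mul_assoc, map_smul, h ht]
    · simp only [Set.ofPred_forall]
      exact isClosed_iInter fun t => isClosed_iInter fun _ =>
        isClosed_eq (hEc.comp (by fun_prop)) (hEc.comp (by fun_prop))
  · simp
  · intro c c' h h' t ht
    simp only [add_mul, map_add, h ht, h' ht]
  · intro z c h t ht
    simp only [smul_mul_assoc, map_smul, h ht]
  · simp only [Set.ofPred_forall]
    exact isClosed_iInter fun t => isClosed_iInter fun _ =>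
      isClosed_eq (hEc.comp (by fun_prop)) (hEc.comp (by fun_prop))

/-- Subordination for monotone independence: `F_{X + x}(w) = F_X(F_x(w))` for `X ≺ x`. -/
lemma MonotoneIndependent.map_G_sum_insert (hE : IsOVCStarProbabilitySpace B E)
    (hx : ∀ j, IsSelfAdjoint (x j))
    (hm : MonotoneIndependent E fun j => bimoduleAlgebra B (x j)) {s : Finset Λ} {i : Λ}
    (hs : ∀ j ∈ s, j < i) {β : ℝ} (hβ : 0 < β) {w : A} (hwB : w ∈ B)
    (hw : algebraMap ℝ A β ≤ (ℑ w : A)) :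
    E (G (∑ j ∈ insert i s, x j) w) = E (G (∑ j ∈ s, x j) (reciprocalCauchy E (x i) w)) := by
  set X := ∑ j ∈ s, x j with hX
  have hXsa : IsSelfAdjoint X := isSelfAdjoint_sum _ fun j _ => hx j
  rw [Finset.sum_insert fun hi => (hs i hi).false, ← hX]
  have hXxsa : IsSelfAdjoint (x i + X) := (hx i).add hXsa
  set H := G (x i + X) w
  set R := G (x i) w
  have hR1 : R * (w - x i) = 1 := G_mul_sub hβ hw (hx i)
  have hH : (w - (x i + X)) * H = 1 := sub_mul_G hβ hw hXxsa
  have hHR : H = R + R * X * H := by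
    calc H = R * (w - x i) * H := by rw [hR1, one_mul]
      _ = R * ((w - (x i + X)) * H) + R * X * H := by noncomm_ring
      _ = _ := by rw [hH, mul_one]
  have hwmem : ∀ I, w ∈ generatedAlgebra B x I := fun I => mem_generatedAlgebra_of_mem hwB
  have hRmem : R ∈ generatedAlgebra B x {i} :=
    inverse_mem_generatedAlgebra (sub_mem (hwmem _) (apply_mem_generatedAlgebra rfl))
  have hXmem : ∀ I : Set Λ, (↑s ⊆ I) → X ∈ generatedAlgebra B x I := fun I hI =>
    sum_mem fun j hj => apply_mem_generatedAlgebra (hI hj)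
  have hHmem : H ∈ generatedAlgebra B x Set.univ :=
    inverse_mem_generatedAlgebra (sub_mem (hwmem _)
      (add_mem (apply_mem_generatedAlgebra trivial) (hXmem _ (Set.subset_univ _))))
  obtain ⟨hgu, hF⟩ := isUnit_map_G_and_le_imaginaryPart_reciprocalCauchy hβ hw (hx i) hE
  set F := reciprocalCauchy E (x i) w
  have hgF : E R * F = 1 := Ring.mul_inverse_cancel _ hgu
  have hFX : E R * (F - X) = 1 - E R * X := by rw [mul_sub, hgF]
  have hu : IsUnit (1 - E R * X) := by
    rw [← hFX]
    exact hgu.mul (isUnit_sub hβ hF hXsa)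
  -- `a` is chosen so that the resulting equation `E[a (1 - E[R] X) H] = E[a E[R]]` solves for
  -- `E[H]`
  set a := Ring.inverse (1 - E R * X)
  have ha1 : a * (1 - E R * X) = 1 := Ring.inverse_mul_cancel _ hu
  have ha : a ∈ generatedAlgebra B x s :=
    inverse_mem_generatedAlgebra (sub_mem (one_mem _)
      (mul_mem (mem_generatedAlgebra_of_mem (hE.mem R)) (hXmem _ subset_rfl)))
  -- in `H = R + R X H`, left multiplied by `a`, each `R` may be replaced by `E R`
  have key : E (a * H) = E (a * E R) + E (a * E R * X * H) := by
    conv_lhs => rw [hHR]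
    rw [mul_add, map_add]
    congr 1
    · simpa using hm.map_mul_mul hE hx (t := 1) hs ha hRmem (.inl rfl)
    · have : ∀ z : A, a * z * X * H = ∑ j ∈ s, a * z * (x j * H) := fun z => by
        rw [hX, mul_assoc, Finset.sum_mul, Finset.mul_sum]
      rw [← mul_assoc, ← mul_assoc, this, this, map_sum, map_sum]
      exact Finset.sum_congr rfl fun j hj =>
        hm.map_mul_mul hE hx hs ha hRmem (.inr ⟨j, hs j hj, H, hHmem, rfl⟩)
  have h1 : a * E R = G X F := by
    calc a * E R = a * (E R * (F - X)) * G X F := by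
          rw [mul_assoc, mul_assoc, sub_mul_G hβ hF hXsa, mul_one]
      _ = _ := by rw [hFX, ha1, one_mul]
  have h2 : H = a * H - a * E R * X * H := by
    calc H = a * (1 - E R * X) * H := by rw [ha1, one_mul]
      _ = _ := by noncomm_ring
  rw [h2, map_sub, key, add_sub_cancel_right, h1]

end OVProb

/-! ### The exchange in the operator-valued upper half-plane -/

namespace OVProb

variable {A : Type*} [CStarAlgebra A] [PartialOrder A] [StarOrderedRing A]
  {B : Subalgebra ℂ A} {E : A →CP A}

lemma IsOVCStarProbabilitySpace.norm_map_le_of_nonneg (hE : IsOVCStarProbabilitySpace B E) {a : A}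
    (ha : 0 ≤ a) : ‖E a‖ ≤ ‖a‖ := by
  have h1 := OrderHomClass.mono E
    (IsSelfAdjoint.le_algebraMap_norm_self (IsSelfAdjoint.of_nonneg ha))
  have h2 : (algebraMap ℝ A ‖a‖) ∈ B := by
    rw [Algebra.algebraMap_eq_smul_one, ← Complex.coe_smul]
    exact B.smul_mem (one_mem B) _
  rw [hE.map_self _ h2] at h1
  have h3 := CStarAlgebra.norm_le_norm_of_nonneg_of_le (map_nonneg E ha) h1
  rcases subsingleton_or_nontrivial A with hA | hA
  · rw [Subsingleton.elim (E a) a]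
  · rwa [norm_algebraMap', Real.norm_of_nonneg (norm_nonneg a)] at h3

omit [PartialOrder A] [StarOrderedRing A] in
lemma mul_mul_sq_mul_star_mul_eq {x : A} (hx : IsSelfAdjoint x) (b : A) :
    x * b * x ^ 2 * star b * x = (x * b * x) * star (x * b * x) := by
  simp only [star_mul, hx.star_eq, sq, mul_assoc]

omit [PartialOrder A] [StarOrderedRing A] in
lemma norm_map_sq_le_alpha₂ (E : A → A) {N : ℕ} (x : Fin N → A) (i : Fin N) :
    ‖E (x i ^ 2)‖ ≤ alpha₂ E x :=
  le_ciSup (f := fun i => ‖E (x i ^ 2)‖) (Set.finite_range _).bddAbove i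

omit [PartialOrder A] [StarOrderedRing A] in
lemma norm_map_pow_four_le_alphaTilde₄ (E : A → A) {N : ℕ} (x : Fin N → A) (i : Fin N) :
    ‖E (x i ^ 4)‖ ≤ alphaTilde₄ E x :=
  le_ciSup (f := fun i => ‖E (x i ^ 4)‖) (Set.finite_range _).bddAbove i

lemma norm_map_le_sq_mul_alpha₄ (hE : IsOVCStarProbabilitySpace B E) {N : ℕ} {x : Fin N → A}
    (hx : ∀ j, IsSelfAdjoint (x j)) (i : Fin N) {b : A} (hb : b ∈ B) :
    ‖E (x i * b * x i ^ 2 * star b * x i)‖ ≤ ‖b‖ ^ 2 * alpha₄ B E x := by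
  rcases eq_or_ne b 0 with rfl | hb0
  · simp
  have hn : ‖b‖ ≠ 0 := norm_ne_zero_iff.2 hb0
  have hbdd : BddAbove (Set.range fun b : {b : A // b ∈ B ∧ ‖b‖ = 1} =>
      ‖E (x i * star b.1 * x i ^ 2 * b.1 * x i)‖) := by
    refine ⟨‖x i‖ ^ 4, ?_⟩
    rintro _ ⟨⟨b, hb, hb1⟩, rfl⟩
    have h1 := mul_mul_sq_mul_star_mul_eq (hx i) (star b)
    rw [star_star] at h1
    simp only [h1]
    refine (hE.norm_map_le_of_nonneg (mul_star_self_nonneg _)).trans ?_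
    rw [CStarRing.norm_self_mul_star]
    have h2 : ‖x i * star b * x i‖ ≤ ‖x i‖ * ‖x i‖ := by
      refine (norm_mul_le _ _).trans ?_
      gcongr
      refine (norm_mul_le _ _).trans ?_
      rw [norm_star, hb1, mul_one]
    calc _ ≤ (‖x i‖ * ‖x i‖) * (‖x i‖ * ‖x i‖) := by gcongr
      _ = _ := by ring
  let c : {b : A // b ∈ B ∧ ‖b‖ = 1} := ⟨((‖b‖⁻¹ : ℝ) : ℂ) • star b,
    B.smul_mem (hE.star_mem hb) _, by
      rw [norm_smul, norm_star, Complex.norm_real, norm_inv, norm_norm, inv_mul_cancel₀ hn]⟩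
  have h1 := le_ciSup hbdd c
  have h2 : ‖E (x i * star c.1 * x i ^ 2 * c.1 * x i)‖ =
      (‖b‖ ^ 2)⁻¹ * ‖E (x i * b * x i ^ 2 * star b * x i)‖ := by
    have : x i * star c.1 * x i ^ 2 * c.1 * x i =
        (((‖b‖ ^ 2)⁻¹ : ℝ) : ℂ) • (x i * b * x i ^ 2 * star b * x i) := by
      simp only [c, star_smul, star_star, mul_smul_comm, smul_mul_assoc, smul_smul]
      congr 1
      rw [Complex.star_def, Complex.conj_ofReal]
      push_cast
      ring
    rw [this, map_smul, norm_smul, Complex.norm_real, Real.norm_of_nonneg (by positivity)]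
  have h3 : (‖b‖ ^ 2)⁻¹ * ‖E (x i * b * x i ^ 2 * star b * x i)‖ ≤ alpha₄ B E x := by
    rw [← h2]
    exact h1.trans (le_ciSup (f := fun i => ⨆ b : {b : A // b ∈ B ∧ ‖b‖ = 1},
      ‖E (x i * star b.1 * x i ^ 2 * b.1 * x i)‖) (Set.finite_range _).bddAbove i)
  rwa [inv_mul_le_iff₀ (by positivity)] at h3

omit [PartialOrder A] [StarOrderedRing A] in
lemma alpha₄_nonneg (B : Subalgebra ℂ A) (E : A → A) {N : ℕ} (x : Fin N → A) :
    0 ≤ alpha₄ B E x :=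
  Real.iSup_nonneg fun _ => Real.iSup_nonneg fun _ => norm_nonneg _

omit [PartialOrder A] [StarOrderedRing A] in
lemma inverse_algebraMap {𝕜 : Type*} [Field 𝕜] [Algebra 𝕜 A] [Nontrivial A] (c : 𝕜) :
    Ring.inverse (algebraMap 𝕜 A c) = algebraMap 𝕜 A c⁻¹ := by
  rcases eq_or_ne c 0 with rfl | hc
  · simp
  · refine ((IsUnit.mk0 c hc).map (algebraMap 𝕜 A)).mul_left_cancel ?_
    rw [Ring.mul_inverse_cancel _ ((IsUnit.mk0 c hc).map (algebraMap 𝕜 A)), ← map_mul,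
      mul_inv_cancel₀ hc, map_one]

/-- A strictly positive element is at least the inverse of the norm of its inverse. -/
lemma algebraMap_inv_norm_inverse_le [Nontrivial A] {h : A} (hh : IsStrictlyPositive h) :
    0 < ‖Ring.inverse h‖ ∧ algebraMap ℝ A ‖Ring.inverse h‖⁻¹ ≤ h := by
  have hu := hh.isUnit
  have hi : Ring.inverse h ≠ 0 := hu.ringInverse.ne_zero
  have hn : 0 < ‖Ring.inverse h‖ := norm_pos_iff.2 hi
  refine ⟨hn, ?_⟩
  have hpos : IsStrictlyPositive (Ring.inverse h) := by
    refine IsStrictlyPositive.iff_of_unital.2 ⟨?_, hu.ringInverse⟩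
    have h1 := star_left_conjugate_nonneg hh.nonneg (Ring.inverse h)
    rwa [(IsSelfAdjoint.of_nonneg hh.nonneg).ringInverse.star_eq, mul_assoc,
      Ring.mul_inverse_cancel _ hu, mul_one] at h1
  have h1 := CStarAlgebra.ringInverse_le_ringInverse
    (IsSelfAdjoint.le_algebraMap_norm_self (IsSelfAdjoint.of_nonneg hpos.nonneg)) hpos
  have h2 : Ring.inverse (algebraMap ℝ A ‖Ring.inverse h‖) =
      algebraMap ℝ A ‖Ring.inverse h‖⁻¹ := by
    rw [inverse_algebraMap]
  rwa [h2, Ring.inverse_inverse hu] at h1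

section Exchange

variable {N : ℕ} {x y : Fin N → A}

/-- The Lindeberg exchange of all the variables in `s`, from the largest to the smallest. The bound
is uniform in `β ≤ ℑ w`, as the induction passes from `w` to `F_y(w)`. -/
lemma norm_map_G_sum_sub_le (hE : IsOVCStarProbabilitySpace B E)
    (hx : ∀ j, IsSelfAdjoint (x j)) (hy : ∀ j, IsSelfAdjoint (y j))
    (hEx : ∀ j, E (x j) = 0) (hEy : ∀ j, E (y j) = 0)
    (hvar : ∀ j, ∀ b ∈ B, E (x j * b * x j) = E (y j * b * y j))
    (hmx : MonotoneIndependent E (fun j => bimoduleAlgebra B (x j)))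
    (hmy : MonotoneIndependent E (fun j => bimoduleAlgebra B (y j)))
    {β : ℝ} (hβ : 0 < β) (s : Finset (Fin N)) :
    ∀ w ∈ B, algebraMap ℝ A β ≤ (ℑ w : A) →
      ‖E (G (∑ i ∈ s, x i) w) - E (G (∑ i ∈ s, y i) w)‖ ≤
        β⁻¹ ^ 4 * √(alpha₂ E x) * (√(alpha₄ B E x) + √(alpha₄ B E y)) * s.card := by
  induction s using Finset.induction_on_max with
  | empty => simp
  | insert i s hs ih =>
    intro w hwB hw
    set X := ∑ j ∈ s, x j
    have hX : IsSelfAdjoint X := isSelfAdjoint_sum _ fun j _ => hx j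
    rw [hmx.map_G_sum_insert hE hx hs hβ hwB hw, hmy.map_G_sum_insert hE hy hs hβ hwB hw,
      Finset.card_insert_of_notMem fun hi => (hs i hi).false]
    have h1 := ih _ (reciprocalCauchy_mem hE (y i) w)
      (isUnit_map_G_and_le_imaginaryPart_reciprocalCauchy hβ hw (hy i) hE).2
    have h2 := norm_map_G_reciprocalCauchy_sub_le hE hβ hwB hw hX (hx i) (hy i) (hEx i) (hEy i)
      (hvar i)
    have hu : ‖Ring.inverse w‖ ≤ β⁻¹ := norm_inverse_le_of_le_imaginaryPart hβ hw
    have h4 : ∀ z : Fin N → A, (∀ j, IsSelfAdjoint (z j)) →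
        √‖E (z i * Ring.inverse w * z i ^ 2 * star (Ring.inverse w) * z i)‖ ≤
          β⁻¹ * √(alpha₄ B E z) := fun z hz => by
      rw [← Real.sqrt_sq (inv_pos.2 hβ).le, ← Real.sqrt_mul (by positivity)]
      refine Real.sqrt_le_sqrt ((norm_map_le_sq_mul_alpha₄ hE hz i (hE.inverse_mem hwB)).trans ?_)
      have := alpha₄_nonneg B E z
      gcongr
    have hG := norm_G_le hβ hw hX
    have h5 : √(‖E (G X w * star (G X w))‖ * ‖E (star (G X w) * G X w)‖) ≤ β⁻¹ ^ 2 := by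
      refine Real.sqrt_le_iff.2 ⟨by positivity, ?_⟩
      have e1 := hE.norm_map_le_of_nonneg (mul_star_self_nonneg (G X w))
      have e2 := hE.norm_map_le_of_nonneg (star_mul_self_nonneg (G X w))
      rw [CStarRing.norm_self_mul_star] at e1
      rw [CStarRing.norm_star_mul_self] at e2
      calc _ ≤ (‖G X w‖ * ‖G X w‖) * (‖G X w‖ * ‖G X w‖) := by gcongr
        _ ≤ (β⁻¹ * β⁻¹) * (β⁻¹ * β⁻¹) := by gcongr
        _ = _ := by ring
    have h6 : ‖E (G X (reciprocalCauchy E (x i) w)) - E (G X (reciprocalCauchy E (y i) w))‖ ≤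
        β⁻¹ ^ 4 * √(alpha₂ E x) * (√(alpha₄ B E x) + √(alpha₄ B E y)) := by
      calc _ ≤ _ := h2
        _ ≤ β⁻¹ * √(alpha₂ E x) * (β⁻¹ * √(alpha₄ B E x) + β⁻¹ * √(alpha₄ B E y)) *
            β⁻¹ ^ 2 := by
          gcongr
          · exact norm_map_sq_le_alpha₂ E x i
          · exact h4 x hx
          · exact h4 y hy
        _ = _ := by ring
    calc _ ≤ _ := norm_sub_le_norm_sub_add_norm_sub _ (E (G X (reciprocalCauchy E (y i) w))) _
      _ ≤ _ := add_le_add h6 h1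
      _ = _ := by push_cast; ring

end Exchange

end OVProb

/-! ### Cauchy transforms on horizontal lines -/

namespace OVProb

section HalfPlane

open Complex MeasureTheory Filter Topology

lemma intervalIntegral_div_sq_add_sq_le {ε : ℝ} (hε : 0 < ε) (T : ℝ) :
    ∫ t in (-T)..T, ε / (t ^ 2 + ε ^ 2) ≤ Real.pi := by
  have hd : ∀ t ∈ Set.uIcc (-T) T,
      HasDerivAt (fun t => Real.arctan (t / ε)) (ε / (t ^ 2 + ε ^ 2)) t := by
    intro t _
    have := ((hasDerivAt_id t).div_const ε).arctan
    convert this using 1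
    simp only [id]
    field_simp
    rw [add_comm, id]
  have hc : Continuous fun t : ℝ => ε / (t ^ 2 + ε ^ 2) :=
    continuous_const.div (by fun_prop) fun t => by positivity
  rw [intervalIntegral.integral_eq_sub_of_hasDerivAt hd (hc.intervalIntegrable _ _)]
  have h1 := Real.arctan_lt_pi_div_two (T / ε)
  have h2 := Real.neg_pi_div_two_lt_arctan (-T / ε)
  linarith

/-- The Cauchy theorem on the rectangle with vertices `±T + iε` and `±T + i(T + ε)`, for a function
of size `O(|z|⁻²)`. -/
lemma norm_intervalIntegral_le_of_differentiableOn {k : ℂ → ℂ} {ε C R T : ℝ} (hε : 0 < ε)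
    (hd : DifferentiableOn ℂ k {z | 0 < z.im}) (hT : 0 < T) (hRT : R ≤ T)
    (hk : ∀ z : ℂ, ε ≤ z.im → R ≤ ‖z‖ → ‖k z‖ ≤ C / ‖z‖ ^ 2) (hC : 0 ≤ C) :
    ‖∫ t : ℝ in (-T)..T, k (t + ε * I)‖ ≤ 4 * C / T := by
  have hrect := Complex.integral_boundary_rect_eq_zero_of_differentiableOn k
    (-T + ε * I) (T + (T + ε) * I) (hd.mono fun z hz => by
      have h1 := (Complex.mem_reProdIm.1 hz).2
      simp at h1
      rw [Set.uIcc_of_le (by linarith)] at h1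
      exact hε.trans_le h1.1)
  simp only [add_re, neg_re, ofReal_re, mul_re, I_re, mul_zero, ofReal_im, I_im, mul_one,
    add_im, neg_im, mul_im, sub_self, add_zero, neg_zero, zero_add,
    ofReal_add, ofReal_neg, smul_eq_mul] at hrect
  have hb : ∀ z : ℂ, ε ≤ z.im → T ≤ ‖z‖ → ‖k z‖ ≤ C / T ^ 2 := fun z h1 h2 =>
    (hk z h1 (hRT.trans h2)).trans (by gcongr)
  have htop : ‖∫ t : ℝ in (-T)..T, k (t + (T + ε) * I)‖ ≤ C / T ^ 2 * |T - -T| := by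
    refine intervalIntegral.norm_integral_le_of_norm_le_const fun t _ => hb _ ?_ ?_
    · simp; linarith
    · refine le_trans ?_ (Complex.abs_im_le_norm _)
      simp
      exact (le_abs_self _).trans' (by linarith)
  have hside : ∀ S : ℝ, |S| = T →
      ‖∫ y : ℝ in ε..(T + ε), k (S + y * I)‖ ≤ C / T ^ 2 * |T + ε - ε| := by
    intro S hS
    refine intervalIntegral.norm_integral_le_of_norm_le_const fun t ht => hb _ ?_ ?_
    · rw [Set.uIoc_of_le (by linarith)] at ht
      simpa using ht.1.le
    · refine le_trans ?_ (Complex.abs_re_le_norm _)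
      simp [hS]
  have h1 := hside T (abs_of_pos hT)
  have h2 := hside (-T) (by rw [abs_neg, abs_of_pos hT])
  rw [ofReal_neg] at h2
  have hbot : ∫ t : ℝ in (-T)..T, k (t + ε * I) =
      (∫ t : ℝ in (-T)..T, k (t + (T + ε) * I)) - I * (∫ y : ℝ in ε..(T + ε), k (T + y * I)) +
        I * (∫ y : ℝ in ε..(T + ε), k (-T + y * I)) := by
    linear_combination hrect
  rw [hbot]
  refine (norm_add_le _ _).trans ?_
  have h3 := norm_sub_le (∫ t : ℝ in (-T)..T, k (t + (T + ε) * I))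
    (I * (∫ y : ℝ in ε..(T + ε), k (T + y * I)))
  rw [norm_mul, norm_I, one_mul] at h3 ⊢
  rw [show T - -T = 2 * T by ring, abs_of_pos (by positivity)] at htop
  rw [add_sub_cancel_right, abs_of_pos hT] at h1 h2
  have h4 : 4 * C / T = C / T ^ 2 * (2 * T) + C / T ^ 2 * T + C / T ^ 2 * T := by
    field_simp; ring
  linarith

lemma continuous_horizontal {h : ℂ → ℂ} {ε : ℝ} (hε : 0 < ε)
    (hd : DifferentiableOn ℂ h {z | 0 < z.im}) : Continuous fun t : ℝ => h (t + ε * I) :=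
  hd.continuousOn.comp_continuous (by fun_prop) fun t => by simpa using hε

/-- A function which behaves like `1 / z` at infinity in the half-plane, as the Cauchy transform of
a probability measure does, and has nonpositive imaginary part on a horizontal line: the integral of
that imaginary part is at least `-π`. -/
lemma integrable_im_and_integral_neg_im_le {h : ℂ → ℂ} {ε C R : ℝ} (hε : 0 < ε)
    (hd : DifferentiableOn ℂ h {z | 0 < z.im}) (hneg : ∀ t : ℝ, (h (t + ε * I)).im ≤ 0)
    (hC : 0 ≤ C)
    (hh : ∀ z : ℂ, ε ≤ z.im → R ≤ ‖z‖ → ‖h z - z⁻¹‖ ≤ C / ‖z‖ ^ 2) :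
    Integrable (fun t : ℝ => -(h (t + ε * I)).im) ∧
      ∫ t : ℝ, -(h (t + ε * I)).im ≤ Real.pi := by
  have hcont : Continuous fun t : ℝ => h (t + ε * I) := continuous_horizontal hε hd
  have hcont' : Continuous fun t : ℝ => -(h (t + ε * I)).im :=
    (Complex.continuous_im.comp hcont).neg
  have hdinv : DifferentiableOn ℂ (fun z : ℂ => z⁻¹) {z | 0 < z.im} := fun z hz =>
    (differentiableAt_inv fun h0 => by simp [h0] at hz).differentiableWithinAt
  have hcinv := continuous_horizontal hε hdinv
  have hbound : ∀ T : ℝ, 0 < T → R ≤ T →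
      ∫ t : ℝ in (-T)..T, -(h (t + ε * I)).im ≤ Real.pi + 4 * C / T := by
    intro T hT hRT
    have h1 := norm_intervalIntegral_le_of_differentiableOn (k := fun z => h z - z⁻¹) hε
      (hd.sub hdinv) hT hRT hh hC
    have h2 : (∫ t : ℝ in (-T)..T, (h (t + ε * I) - ((t : ℂ) + ε * I)⁻¹)).im =
        (∫ t : ℝ in (-T)..T, (h (t + ε * I)).im) + ∫ t in (-T)..T, ε / (t ^ 2 + ε ^ 2) := by
      have hc1 : Continuous fun t : ℝ => (h (t + ε * I)).im := Complex.continuous_im.comp hcont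
      have hc2 : Continuous fun t : ℝ => ε / (t ^ 2 + ε ^ 2) :=
        continuous_const.div (by fun_prop) fun t => by positivity
      rw [← intervalIntegral.integral_add (hc1.intervalIntegrable _ _)
        (hc2.intervalIntegrable _ _)]
      rw [← Complex.imCLM_apply, ← ContinuousLinearMap.intervalIntegral_comp_comm]
      · refine intervalIntegral.integral_congr fun t _ => ?_
        simp [Complex.inv_im, Complex.normSq_apply]
        ring
      · exact (hcont.sub hcinv).intervalIntegrable _ _
    have h3 := (Complex.abs_im_le_norm _).trans h1
    rw [h2] at h3
    have h4 := intervalIntegral_div_sq_add_sq_le hε T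
    rw [intervalIntegral.integral_neg]
    linarith [neg_le_of_abs_le h3]
  have hint : Integrable (fun t : ℝ => -(h (t + ε * I)).im) := by
    refine integrable_of_intervalIntegral_norm_bounded (Real.pi + 4 * C / 1)
      (fun T => hcont'.integrableOn_Ioc) tendsto_neg_atTop_atBot tendsto_id ?_
    filter_upwards [eventually_ge_atTop R, eventually_ge_atTop 1] with T hR h1
    have : ∀ t : ℝ, ‖-(h (t + ε * I)).im‖ = -(h (t + ε * I)).im := fun t =>
      Real.norm_of_nonneg (by linarith [hneg t])
    simp only [this]
    refine (hbound T (by linarith) hR).trans ?_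
    gcongr
  refine ⟨hint, ?_⟩
  have hlim := intervalIntegral_tendsto_integral hint tendsto_neg_atTop_atBot tendsto_id
  have hlim2 : Tendsto (fun T : ℝ => Real.pi + 4 * C / T) atTop (𝓝 (Real.pi + 0)) :=
    tendsto_const_nhds.add (tendsto_const_nhds.div_atTop tendsto_id)
  rw [add_zero] at hlim2
  refine le_of_tendsto_of_tendsto hlim hlim2 ?_
  filter_upwards [eventually_ge_atTop R, eventually_gt_atTop 0] with T hR h1
  exact hbound T h1 hR

/-- Analytic self-maps `w` of the upper half-plane which do not decrease the imaginary part and stay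
at bounded distance from the identity near infinity, as reciprocal Cauchy transforms do. -/
structure IsSubordination (w : ℂ → ℂ) : Prop where
  differentiableOn : DifferentiableOn ℂ w {z | 0 < z.im}
  im_le : ∀ z : ℂ, 0 < z.im → z.im ≤ (w z).im
  norm_sub_le : ∀ ε : ℝ, 0 < ε → ∃ K R : ℝ, 0 ≤ K ∧
    ∀ z : ℂ, ε ≤ z.im → R ≤ ‖z‖ → ‖w z - z‖ ≤ K

lemma isSubordination_id : IsSubordination id where
  differentiableOn := differentiableOn_id
  im_le _ _ := le_rfl
  norm_sub_le _ _ := ⟨0, 0, le_rfl, by simp⟩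

lemma IsSubordination.comp {f w : ℂ → ℂ} (hf : IsSubordination f) (hw : IsSubordination w) :
    IsSubordination (f ∘ w) where
  differentiableOn := hf.differentiableOn.comp hw.differentiableOn fun z hz =>
    hz.trans_le (hw.im_le z hz)
  im_le z hz := (hw.im_le z hz).trans (hf.im_le _ (hz.trans_le (hw.im_le z hz)))
  norm_sub_le ε hε := by
    obtain ⟨K, R, hK, h⟩ := hw.norm_sub_le ε hε
    obtain ⟨K', R', hK', h'⟩ := hf.norm_sub_le ε hε
    refine ⟨K' + K, max R (R' + K), by positivity, fun z hz hzR => ?_⟩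
    have h1 := h z hz ((le_max_left _ _).trans hzR)
    have h2 : R' ≤ ‖w z‖ := by
      have := norm_sub_norm_le z (w z)
      rw [norm_sub_rev] at this
      linarith [(le_max_right _ _).trans hzR]
    have h3 := h' (w z) (hz.trans (hw.im_le z (hε.trans_le hz))) h2
    exact (norm_sub_le_norm_sub_add_norm_sub _ (w z) _).trans (add_le_add h3 h1)

end HalfPlane

end OVProb

/-! ### The integrated exchange for scalar-valued expectations -/

namespace OVProb

open Complex MeasureTheory

variable {A : Type*} [CStarAlgebra A]

lemma imaginaryPart_algebraMap (z : ℂ) :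
    (ℑ (algebraMap ℂ A z) : A) = algebraMap ℝ A z.im := by
  rw [Algebra.algebraMap_eq_smul_one, imaginaryPart_smul, (IsSelfAdjoint.one A).imaginaryPart,
    smul_zero, zero_add, Algebra.algebraMap_eq_smul_one, selfAdjoint.val_smul,
    (IsSelfAdjoint.one A).coe_realPart]

lemma star_G_mul_G_eq {X : A} (hX : IsSelfAdjoint X) (z : ℂ) :
    G X (algebraMap ℂ A z) * star (G X (algebraMap ℂ A z)) =
      star (G X (algebraMap ℂ A z)) * G X (algebraMap ℂ A z) := by
  have h1 : star (G X (algebraMap ℂ A z)) = G X (algebraMap ℂ A (star z)) := by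
    rw [G, G, ← Ring.inverse_star, star_sub, hX.star_eq, algebraMap_star_comm]
  rw [h1]
  refine (Commute.ringInverse_ringInverse ?_).eq
  exact Commute.sub_left (Algebra.commutes z _)
    (Commute.sub_right (Algebra.commutes (star z) X).symm (Commute.refl X))

variable [PartialOrder A] [StarOrderedRing A] {E : A →CP A}

section Scalar

omit [StarOrderedRing A] in
lemma le_imaginaryPart_algebraMap (z : ℂ) :
    algebraMap ℝ A z.im ≤ (ℑ (algebraMap ℂ A z) : A) := (imaginaryPart_algebraMap z).ge

variable {φ : A →ₗ[ℂ] ℂ} (hE : IsOVCStarProbabilitySpace (⊥ : Subalgebra ℂ A) E)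
  (hφ : ∀ a, E a = algebraMap ℂ A (φ a)) [Nontrivial A]

lemma le_imaginaryPart_algebraMap_iff {β : ℝ} {z : ℂ} :
    algebraMap ℝ A β ≤ (ℑ (algebraMap ℂ A z) : A) ↔ β ≤ z.im := by
  rw [imaginaryPart_algebraMap]
  exact algebraMap_le_algebraMap

lemma sqrt_norm_map_le_mul_sqrt_alphaTilde₄ {N : ℕ} {z : Fin N → A} (i : Fin N)
    {β : ℝ} (hβ : 0 < β) {c : ℂ} (hc : β ≤ c.im) :
    √‖E (z i * Ring.inverse (algebraMap ℂ A c) * z i ^ 2 *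
      star (Ring.inverse (algebraMap ℂ A c)) * z i)‖ ≤ β⁻¹ * √(alphaTilde₄ E z) := by
  have h1 : z i * algebraMap ℂ A c⁻¹ * z i ^ 2 * algebraMap ℂ A (star c⁻¹) * z i =
      (c⁻¹ * star c⁻¹) • z i ^ 4 := by
    rw [Algebra.algebraMap_eq_smul_one, Algebra.algebraMap_eq_smul_one]
    simp only [mul_smul_comm, smul_mul_assoc, mul_one, smul_smul]
    rw [mul_comm]
    congr 1
    noncomm_ring
  rw [inverse_algebraMap, ← algebraMap_star_comm, h1, map_smul, norm_smul, norm_mul, norm_star,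
    Real.sqrt_mul (by positivity), Real.sqrt_mul_self (norm_nonneg _), norm_inv]
  gcongr
  · exact hc.trans ((le_abs_self _).trans (Complex.abs_im_le_norm c))
  · exact norm_map_pow_four_le_alphaTilde₄ E z i

include hφ

lemma norm_map_eq_norm_apply (a : A) : ‖E a‖ = ‖φ a‖ := by rw [hφ, norm_algebraMap']

lemma continuous_of_map_eq : Continuous φ := by
  obtain ⟨C, hC⟩ := PositiveLinearMap.exists_norm_apply_le (PositiveLinearMap.ofClass E)
  refine AddMonoidHomClass.continuous_of_bound φ C fun a => ?_
  rw [← norm_map_eq_norm_apply hφ]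
  exact hC a

lemma reciprocalCauchy_algebraMap (x : A) (z : ℂ) :
    reciprocalCauchy E x (algebraMap ℂ A z) =
      algebraMap ℂ A (φ (G x (algebraMap ℂ A z)))⁻¹ := by
  rw [reciprocalCauchy, hφ, inverse_algebraMap]

lemma differentiableOn_apply_G {X : A} (hX : IsSelfAdjoint X) :
    DifferentiableOn ℂ (fun z => φ (G X (algebraMap ℂ A z))) {z | 0 < z.im} := by
  intro z hz
  have hu : IsUnit (algebraMap ℂ A z - X) := isUnit_sub hz (le_imaginaryPart_algebraMap z) hX
  have h1 : DifferentiableAt ℂ (fun z => algebraMap ℂ A z - X) z := by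
    simp only [Algebra.algebraMap_eq_smul_one]
    fun_prop
  have h2 : DifferentiableAt ℂ (fun z => Ring.inverse (algebraMap ℂ A z - X)) z := by
    have := differentiableAt_inverse (𝕜 := ℂ) hu
    exact this.comp z h1
  exact ((⟨φ, continuous_of_map_eq hφ⟩ : A →L[ℂ] ℂ).differentiableAt.comp z
    h2).differentiableWithinAt

/-- The squared `L²`-norm of the resolvent in terms of the imaginary part of the Cauchy
transform. -/
lemma mul_norm_map_star_G_mul_G_le {X : A} (hX : IsSelfAdjoint X) {β : ℝ} (hβ : 0 < β) {z : ℂ}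
    (hz : β ≤ z.im) :
    β * ‖E (star (G X (algebraMap ℂ A z)) * G X (algebraMap ℂ A z))‖ ≤
      -(φ (G X (algebraMap ℂ A z))).im := by
  have hle : algebraMap ℝ A β ≤ (ℑ (algebraMap ℂ A z) : A) := le_imaginaryPart_algebraMap_iff.2 hz
  set H := G X (algebraMap ℂ A z)
  have h1 := OrderHomClass.mono E (smul_star_G_mul_G_le hβ hle hX)
  rw [map_imaginaryPart E, map_star E, ← Complex.coe_smul, map_smul, Complex.coe_smul, hφ H,
    ← algebraMap_star_comm, imaginaryPart_algebraMap] at h1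
  have h0 : 0 ≤ β • E (star H * H) := smul_nonneg hβ.le (map_nonneg E (star_mul_self_nonneg H))
  have h2 := CStarAlgebra.norm_le_norm_of_nonneg_of_le h0 h1
  have h3 : 0 ≤ (star (φ H)).im := by
    have := h0.trans h1
    rw [← map_zero (algebraMap ℝ A)] at this
    exact algebraMap_le_algebraMap.1 this
  rw [norm_smul, norm_algebraMap', Real.norm_of_nonneg hβ.le, Real.norm_of_nonneg h3] at h2
  simpa using h2

include hE

lemma apply_one_of_map_eq : φ 1 = 1 := by
  have := hφ 1
  rw [hE.map_self 1 (one_mem _)] at this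
  exact (algebraMap ℂ A).injective (by rw [← this, map_one])

/-- The first-order expansion of a Cauchy transform at infinity. -/
lemma exists_norm_apply_G_sub_inv_le {X : A} (hX : IsSelfAdjoint X) {ε : ℝ} (hε : 0 < ε) :
    ∃ K : ℝ, 0 ≤ K ∧ ∀ z : ℂ, ε ≤ z.im →
      ‖φ (G X (algebraMap ℂ A z)) - z⁻¹‖ ≤ K / ‖z‖ ^ 2 := by
  let Φ : A →L[ℂ] ℂ := ⟨φ, continuous_of_map_eq hφ⟩
  refine ⟨‖Φ‖ * (‖X‖ + ‖X‖ * ‖X‖ * ε⁻¹), by positivity, fun z hz => ?_⟩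
  have hz0 : z ≠ 0 := fun h => by simp [h] at hz; linarith
  set H := G X (algebraMap ℂ A z)
  have hle : algebraMap ℝ A ε ≤ (ℑ (algebraMap ℂ A z) : A) := le_imaginaryPart_algebraMap_iff.2 hz
  have h1 : (algebraMap ℂ A z - X) * H = 1 := sub_mul_G hε hle hX
  have hzH : z • H = 1 + X * H := by
    rw [← h1, sub_mul, sub_add_cancel, ← Algebra.smul_def]
  have h2 : z ^ 2 • H = z • (1 : A) + (X + X * X * H) := by
    rw [sq, mul_smul, hzH, smul_add, ← mul_smul_comm, hzH, mul_add, mul_one, mul_assoc]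
  have h3 : z ^ 2 * φ H = z + Φ (X + X * X * H) := by
    have := congrArg φ h2
    rw [map_smul, map_add, map_smul, apply_one_of_map_eq hE hφ, smul_eq_mul, smul_eq_mul,
      mul_one] at this
    exact this
  have h4 : φ H - z⁻¹ = Φ (X + X * X * H) / z ^ 2 := by
    field_simp
    linear_combination h3
  rw [h4, norm_div, norm_pow]
  gcongr
  refine (Φ.le_opNorm _).trans ?_
  gcongr
  refine (norm_add_le _ _).trans ?_
  gcongr
  refine (norm_mul_le _ _).trans ?_
  gcongr
  · exact norm_mul_le _ _
  · exact norm_G_le hε hle hX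

lemma isSubordination_inv_apply_G {x : A} (hx : IsSelfAdjoint x) :
    IsSubordination fun z => (φ (G x (algebraMap ℂ A z)))⁻¹ where
  differentiableOn := by
    refine (differentiableOn_apply_G hφ hx).inv fun z hz => ?_
    have h1 := (isUnit_map_G_and_le_imaginaryPart_reciprocalCauchy hz
      (le_imaginaryPart_algebraMap (A := A) z) hx hE).1
    rw [hφ] at h1
    intro h0
    rw [h0, map_zero] at h1
    exact not_isUnit_zero h1
  im_le z hz := by
    have h1 := (isUnit_map_G_and_le_imaginaryPart_reciprocalCauchy hz
      (le_imaginaryPart_algebraMap (A := A) z) hx hE).2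
    rwa [reciprocalCauchy_algebraMap hφ, le_imaginaryPart_algebraMap_iff] at h1
  norm_sub_le ε hε := by
    obtain ⟨K, hK, h⟩ := exists_norm_apply_G_sub_inv_le hE hφ hx hε
    refine ⟨2 * K, 2 * K, by positivity, fun z hz hzK => ?_⟩
    have hz0 : z ≠ 0 := fun h => by simp [h] at hz; linarith
    have hzn : 0 < ‖z‖ := norm_pos_iff.2 hz0
    set g := φ (G x (algebraMap ℂ A z))
    have h1 := h z hz
    have h2 : (2 * ‖z‖)⁻¹ ≤ ‖g‖ := by
      have h3 := norm_sub_norm_le z⁻¹ g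
      rw [norm_sub_rev, norm_inv] at h3
      have h4 : K / ‖z‖ ^ 2 ≤ (2 * ‖z‖)⁻¹ := by
        rw [div_le_iff₀ (by positivity)]
        field_simp
        linarith
      have h5 : (2 * ‖z‖)⁻¹ = ‖z‖⁻¹ - (2 * ‖z‖)⁻¹ := by field_simp; norm_num
      linarith
    have hg : 0 < ‖g‖ := (by positivity : 0 < (2 * ‖z‖)⁻¹).trans_le h2
    have hg0 : g ≠ 0 := norm_pos_iff.1 hg
    have h3 : g⁻¹ - z = -(z * g⁻¹ * (g - z⁻¹)) := by field_simp; ring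
    rw [h3, norm_neg, norm_mul, norm_mul, norm_inv]
    have h4 : ‖g‖⁻¹ ≤ 2 * ‖z‖ := inv_le_of_inv_le₀ (by positivity) h2
    calc _ ≤ ‖z‖ * (2 * ‖z‖) * (K / ‖z‖ ^ 2) := by gcongr
      _ = _ := by field_simp

/-- Along a subordination map the imaginary part of a Cauchy transform still has integral at most
`π` in absolute value on every horizontal line. -/
lemma integrable_and_integral_neg_im_apply_G_le {X : A} (hX : IsSelfAdjoint X) {w : ℂ → ℂ}
    (hw : IsSubordination w) {ε : ℝ} (hε : 0 < ε) :
    Integrable (fun t : ℝ => -(φ (G X (algebraMap ℂ A (w (t + ε * I))))).im) ∧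
      ∫ t : ℝ, -(φ (G X (algebraMap ℂ A (w (t + ε * I))))).im ≤ Real.pi := by
  obtain ⟨K, hK, h⟩ := exists_norm_apply_G_sub_inv_le hE hφ hX hε
  obtain ⟨K', R, hK', h'⟩ := hw.norm_sub_le ε hε
  refine integrable_im_and_integral_neg_im_le (h := fun z => φ (G X (algebraMap ℂ A (w z))))
    (C := 4 * K + 2 * K') (R := max R (2 * K')) hε ?_ ?_ (by positivity) ?_
  · exact (differentiableOn_apply_G hφ hX).comp hw.differentiableOn fun z hz =>
      hz.trans_le (hw.im_le z hz)
  · intro t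
    have h1 : ε ≤ (w (t + ε * I)).im := by
      simpa using hw.im_le (t + ε * I) (by simpa using hε)
    have := mul_norm_map_star_G_mul_G_le hφ hX hε h1
    have h2 := (by positivity : 0 ≤ ε * ‖E (star (G X (algebraMap ℂ A (w (t + ε * I)))) *
      G X (algebraMap ℂ A (w (t + ε * I))))‖)
    linarith
  · intro z hz hzR
    have h1 := h' z hz ((le_max_left _ _).trans hzR)
    have hwi : ε ≤ (w z).im := hz.trans (hw.im_le z (hε.trans_le hz))
    have h2 := h (w z) hwi
    have hz0 : z ≠ 0 := fun h => by simp [h] at hz; linarith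
    have hw0 : w z ≠ 0 := fun h => by simp [h] at hwi; linarith
    have hzn : 0 < ‖z‖ := norm_pos_iff.2 hz0
    have h3 : ‖z‖ / 2 ≤ ‖w z‖ := by
      have := norm_sub_norm_le z (w z)
      rw [norm_sub_rev] at this
      linarith [(le_max_right _ _).trans hzR]
    have h4 : ‖(w z)⁻¹ - z⁻¹‖ ≤ 2 * K' / ‖z‖ ^ 2 := by
      rw [show (w z)⁻¹ - z⁻¹ = -((w z - z) / (w z * z)) by field_simp; ring, norm_neg, norm_div,
        norm_mul]
      calc _ ≤ K' / (‖z‖ / 2 * ‖z‖) := by gcongr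
        _ = _ := by field_simp
    have h5 : K / ‖w z‖ ^ 2 ≤ 4 * K / ‖z‖ ^ 2 := by
      calc _ ≤ K / (‖z‖ / 2) ^ 2 := by gcongr
        _ = _ := by field_simp; norm_num
    calc _ ≤ _ := norm_sub_le_norm_sub_add_norm_sub _ (w z)⁻¹ _
      _ ≤ _ := add_le_add (h2.trans h5) h4
      _ = _ := by ring

variable {N : ℕ} {x y : Fin N → A}

/-- The integrated Lindeberg exchange, along an arbitrary subordination map `w`; generality in `w`
is what makes the induction work, since the exchange of the largest variable composes `w` with the
reciprocal Cauchy transform of that variable. -/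
lemma integrable_and_integral_norm_apply_G_sum_sub_le
    (hx : ∀ j, IsSelfAdjoint (x j)) (hy : ∀ j, IsSelfAdjoint (y j))
    (hEx : ∀ j, E (x j) = 0) (hEy : ∀ j, E (y j) = 0)
    (hvar : ∀ j, ∀ b ∈ (⊥ : Subalgebra ℂ A), E (x j * b * x j) = E (y j * b * y j))
    (hmx : MonotoneIndependent E (fun j => bimoduleAlgebra ⊥ (x j)))
    (hmy : MonotoneIndependent E (fun j => bimoduleAlgebra ⊥ (y j)))
    {ε : ℝ} (hε : 0 < ε) (s : Finset (Fin N)) :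
    ∀ w : ℂ → ℂ, IsSubordination w →
      Integrable (fun t : ℝ => φ (G (∑ i ∈ s, x i) (algebraMap ℂ A (w (t + ε * I)))) -
        φ (G (∑ i ∈ s, y i) (algebraMap ℂ A (w (t + ε * I))))) ∧
      ∫ t : ℝ, ‖φ (G (∑ i ∈ s, x i) (algebraMap ℂ A (w (t + ε * I)))) -
        φ (G (∑ i ∈ s, y i) (algebraMap ℂ A (w (t + ε * I))))‖ ≤
      Real.pi / ε ^ 3 * √(alpha₂ E x) * (√(alphaTilde₄ E x) + √(alphaTilde₄ E y)) * s.card := by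
  induction s using Finset.induction_on_max with
  | empty => simp
  | insert i s hs ih =>
    intro w hw
    set X := ∑ j ∈ s, x j
    set Y := ∑ j ∈ s, y j
    have hX : IsSelfAdjoint X := isSelfAdjoint_sum _ fun j _ => hx j
    have hfx := (isSubordination_inv_apply_G hE hφ (hx i)).comp hw
    have hfy := (isSubordination_inv_apply_G hE hφ (hy i)).comp hw
    set wx := (fun z => (φ (G (x i) (algebraMap ℂ A z)))⁻¹) ∘ w with hwx
    set wy := (fun z => (φ (G (y i) (algebraMap ℂ A z)))⁻¹) ∘ w with hwy
    have him : ∀ t : ℝ, ε ≤ (w (t + ε * I)).im := fun t => by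
      simpa using hw.im_le (t + ε * I) (by simpa using hε)
    have hle : ∀ t : ℝ, algebraMap ℝ A ε ≤ (ℑ (algebraMap ℂ A (w (t + ε * I))) : A) := fun t =>
      le_imaginaryPart_algebraMap_iff.2 (him t)
    have hmem : ∀ c : ℂ, algebraMap ℂ A c ∈ (⊥ : Subalgebra ℂ A) := fun c =>
      (⊥ : Subalgebra ℂ A).algebraMap_mem c
    have hinj := (algebraMap ℂ A).injective
    have ex : ∀ t : ℝ, φ (G (∑ j ∈ insert i s, x j) (algebraMap ℂ A (w (t + ε * I)))) =
        φ (G X (algebraMap ℂ A (wx (t + ε * I)))) := fun t => by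
      have := hmx.map_G_sum_insert hE hx hs hε (hmem _) (hle t)
      rw [reciprocalCauchy_algebraMap hφ, hφ, hφ] at this
      exact hinj this
    have ey : ∀ t : ℝ, φ (G (∑ j ∈ insert i s, y j) (algebraMap ℂ A (w (t + ε * I)))) =
        φ (G Y (algebraMap ℂ A (wy (t + ε * I)))) := fun t => by
      have := hmy.map_G_sum_insert hE hy hs hε (hmem _) (hle t)
      rw [reciprocalCauchy_algebraMap hφ, hφ, hφ] at this
      exact hinj this
    simp only [ex, ey]
    obtain ⟨hi2, hb2⟩ := ih wy hfy
    obtain ⟨hi0, hb0⟩ := integrable_and_integral_neg_im_apply_G_le hE hφ hX hw hε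
    set c : ℝ := (ε ^ 3)⁻¹ * √(alpha₂ E x) * (√(alphaTilde₄ E x) + √(alphaTilde₄ E y)) with hc
    have hc0 : 0 ≤ c := by positivity
    have hpt : ∀ t : ℝ, ‖φ (G X (algebraMap ℂ A (wx (t + ε * I)))) -
        φ (G X (algebraMap ℂ A (wy (t + ε * I))))‖ ≤
        c * -(φ (G X (algebraMap ℂ A (w (t + ε * I))))).im := fun t => by
      have h2 := norm_map_G_reciprocalCauchy_sub_le hE hε (hmem _) (hle t) hX (hx i) (hy i)
        (hEx i) (hEy i) (hvar i)
      rw [reciprocalCauchy_algebraMap hφ, reciprocalCauchy_algebraMap hφ, ← map_sub,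
        norm_map_eq_norm_apply hφ, map_sub, star_G_mul_G_eq hX, Real.sqrt_mul_self (norm_nonneg _)]
        at h2
      have h3 := mul_norm_map_star_G_mul_G_le hφ hX hε (him t)
      rw [mul_comm, ← le_div_iff₀ hε] at h3
      calc _ ≤ _ := h2
        _ ≤ ε⁻¹ * √(alpha₂ E x) *
            (ε⁻¹ * √(alphaTilde₄ E x) + ε⁻¹ * √(alphaTilde₄ E y)) *
            (-(φ (G X (algebraMap ℂ A (w (t + ε * I))))).im / ε) := by
          gcongr
          · exact norm_map_sq_le_alpha₂ E x i
          · exact sqrt_norm_map_le_mul_sqrt_alphaTilde₄ i hε (him t)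
          · exact sqrt_norm_map_le_mul_sqrt_alphaTilde₄ i hε (him t)
        _ = _ := by rw [hc]; field_simp
    have hcont : ∀ v : ℂ → ℂ, IsSubordination v →
        Continuous fun t : ℝ => φ (G X (algebraMap ℂ A (v (t + ε * I)))) := fun v hv =>
      continuous_horizontal (h := fun z => φ (G X (algebraMap ℂ A (v z)))) hε
        ((differentiableOn_apply_G hφ hX).comp hv.differentiableOn fun z hz =>
          hz.trans_le (hv.im_le z hz))
    have hi1 : Integrable fun t : ℝ => φ (G X (algebraMap ℂ A (wx (t + ε * I)))) -
        φ (G X (algebraMap ℂ A (wy (t + ε * I)))) :=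
      (hi0.const_mul c).mono' ((hcont wx hfx).sub (hcont wy hfy)).aestronglyMeasurable
        (.of_forall hpt)
    have hb1 : ∫ t : ℝ, ‖φ (G X (algebraMap ℂ A (wx (t + ε * I)))) -
        φ (G X (algebraMap ℂ A (wy (t + ε * I))))‖ ≤ c * Real.pi := by
      refine (integral_mono hi1.norm (hi0.const_mul c) hpt).trans ?_
      rw [integral_const_mul]
      gcongr
    have hadd : ∀ t : ℝ, φ (G X (algebraMap ℂ A (wx (t + ε * I)))) -
        φ (G Y (algebraMap ℂ A (wy (t + ε * I)))) =
        (φ (G X (algebraMap ℂ A (wx (t + ε * I)))) -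
          φ (G X (algebraMap ℂ A (wy (t + ε * I))))) +
        (φ (G X (algebraMap ℂ A (wy (t + ε * I)))) -
          φ (G Y (algebraMap ℂ A (wy (t + ε * I))))) := fun t => by ring
    simp only [hadd]
    refine ⟨hi1.add hi2, ?_⟩
    calc _ ≤ _ := integral_mono (hi1.add hi2).norm (hi1.norm.add hi2.norm)
          fun t => norm_add_le _ _
      _ = _ := integral_add hi1.norm hi2.norm
      _ ≤ _ := add_le_add hb1 hb2
      _ = _ := by
        rw [Finset.card_insert_of_notMem fun hi => (hs i hi).false, hc]
        push_cast
        field_simp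
        ring

end Scalar

end OVProb

theorem theorem1p2 {A : Type*} [CStarAlgebra A] [PartialOrder A] [StarOrderedRing A]
    (B : Subalgebra ℂ A) (E : A →CP A) (hE : OVProb.IsOVCStarProbabilitySpace B E)
    (N : ℕ) (x y : Fin N → A)
    (hx : ∀ j, IsSelfAdjoint (x j)) (hy : ∀ j, IsSelfAdjoint (y j))
    (hEx : ∀ j, E (x j) = 0) (hEy : ∀ j, E (y j) = 0)
    (hvar : ∀ j, ∀ b ∈ B, E (x j * b * x j) = E (y j * b * y j))
    (hmx : OVProb.MonotoneIndependent E (fun j => OVProb.bimoduleAlgebra B (x j)))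
    (hmy : OVProb.MonotoneIndependent E (fun j => OVProb.bimoduleAlgebra B (y j))) :
    (∀ b ∈ OVProb.upperHalfPlane B,
      ‖E (OVProb.G (∑ i, x i) b) - E (OVProb.G (∑ i, y i) b)‖ ≤
        ‖Ring.inverse (ℑ b : A)‖ ^ 4 * √(OVProb.alpha₂ E x) *
          (√(OVProb.alpha₄ B E x) + √(OVProb.alpha₄ B E y)) * N) ∧
    (∀ φ : A →ₗ[ℂ] ℂ, B = ⊥ → (∀ a, E a = algebraMap ℂ A (φ a)) →
      ∀ ε : ℝ, 0 < ε →
        MeasureTheory.Integrable (fun t : ℝ =>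
          (φ (OVProb.G (∑ i, x i) (algebraMap ℂ A (t + ε * Complex.I)))).im -
            (φ (OVProb.G (∑ i, y i) (algebraMap ℂ A (t + ε * Complex.I)))).im) ∧
        ∫ t : ℝ, |(φ (OVProb.G (∑ i, x i) (algebraMap ℂ A (t + ε * Complex.I)))).im -
            (φ (OVProb.G (∑ i, y i) (algebraMap ℂ A (t + ε * Complex.I)))).im| ≤
          Real.pi / ε ^ 3 * √(OVProb.alpha₂ E x) *
            (√(OVProb.alphaTilde₄ E x) + √(OVProb.alphaTilde₄ E y)) * N) := by
  rcases subsingleton_or_nontrivial A with hA | hA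
  · refine ⟨fun b _ => ?_, fun φ _ _ ε hε => ?_⟩
    · rw [Subsingleton.elim (E _ - E _) 0, norm_zero]
      positivity
    · have h0 : ∀ a, φ a = 0 := fun a => by rw [Subsingleton.elim a 0, map_zero]
      simp only [h0]
      refine ⟨by simp, ?_⟩
      simp only [Complex.zero_im, sub_self, abs_zero, MeasureTheory.integral_zero]
      positivity
  refine ⟨fun b hb => ?_, ?_⟩
  · obtain ⟨hn, hle⟩ := OVProb.algebraMap_inv_norm_inverse_le hb.2
    have := OVProb.norm_map_G_sum_sub_le hE hx hy hEx hEy hvar hmx hmy (inv_pos.2 hn)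
      Finset.univ b hb.1 hle
    simpa using this
  · rintro φ rfl hφ ε hε
    obtain ⟨h1, h2⟩ := OVProb.integrable_and_integral_norm_apply_G_sum_sub_le hE hφ hx hy hEx hEy
      hvar hmx hmy hε Finset.univ id OVProb.isSubordination_id
    simp only [id, Finset.card_univ, Fintype.card_fin] at h1 h2
    have h3 := h1.im
    refine ⟨by simpa using h3, ?_⟩
    refine le_trans (MeasureTheory.integral_mono ?_ h1.norm fun t => ?_) h2
    · simpa using h3.norm
    · simpa using Complex.abs_im_le_norm (φ (OVProb.G (∑ i, x i) (algebraMap ℂ A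
        (t + ε * Complex.I))) - φ (OVProb.G (∑ i, y i) (algebraMap ℂ A (t + ε * Complex.I))))
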